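/- Identify finite binary strings with natural numbers via the length-lexicographic order, so that a set $X\subseteq\mathbb{N}$ is also a language and can be used as an oracle. Computation time of a multitape oracle Turing machine is counted as usual: the machine has a query tape on which it writes strings, and asking the oracle whether the string currently written there belongs to it takes one step. For $f:\{0,1\}^*\to\mathbb{N}$, a machine decides a language $L\subseteq\{0,1\}^*$ in time $f$ if on every input $x$ it halts within $f(x)$ steps and correctly answers whether $x\in L$. A set $X$ is *low for speed* if for every computable language $L$ and every $f:\{0,1\}^*\to\mathbb{N}$: if some Turing machine with oracle $X$ decides $L$ in time $f$, then there are a Turing machine without oracle and a polynomial $p$ such that this machine decides $L$ in time $p\circ f$. Let $\mathbf{LFS}$ be the set of Turing degrees that contain a low for speed set. A Turing degree is *c.e.* if it contains a computably enumerable set, and *low* if it contains a set $A$ whose Turing jump satisfies $A'\equiv_T\emptyset'$. Let $\mathbf{0}$ be the degree of the computable sets. **Theorem.** For every low c.e. Turing degree $\mathbf{a}>\mathbf{0}$ we have $\mathbf{a}\notin\mathbf{LFS}$; that is, no set in $\mathbf{a}$ is low for speed. -/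

import Mathlib

namespace LowSpeed

/-! ### Strings, sets of natural numbers and Turing degrees -/

/-- The identification of finite binary strings with natural numbers through the
length-lexicographic order: `[] ↦ 0`, `0 ↦ 1`, `1 ↦ 2`, `00 ↦ 3`, `01 ↦ 4`, … -/
def strNum (x : List Bool) : ℕ :=
  x.foldl (fun n b => 2 * n + 1 + b.toNat) 0

open Classical in
/-- The characteristic function of a set of natural numbers. -/
noncomputable def charFun (A : Set ℕ) : ℕ → ℕ :=
  fun n => if n ∈ A then 1 else 0

/-- The Turing degree of a set of natural numbers. -/
noncomputable def deg (A : Set ℕ) : TuringDegree :=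
  toAntisymmetrization TuringReducible (charFun A : ℕ →. ℕ)

/-! ### The Turing jump -/

/-- Programs for partial functions recursive in an oracle; there is one constructor for each
clause of `Nat.RecursiveIn`. -/
inductive OracleCode : Type
  | zero : OracleCode
  | succ : OracleCode
  | left : OracleCode
  | right : OracleCode
  | oracle : OracleCode
  | pair : OracleCode → OracleCode → OracleCode
  | comp : OracleCode → OracleCode → OracleCode
  | prec : OracleCode → OracleCode → OracleCode
  | rfind : OracleCode → OracleCode

namespace OracleCode

/-- The partial function computed by a program with oracle `g`. -/
def eval (g : ℕ → ℕ) : OracleCode → (ℕ →. ℕ)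
  | zero => fun _ => Part.some 0
  | succ => fun n => Part.some (n + 1)
  | left => fun n => Part.some n.unpair.1
  | right => fun n => Part.some n.unpair.2
  | oracle => fun n => Part.some (g n)
  | pair c d => fun n => Nat.pair <$> eval g c n <*> eval g d n
  | comp c d => fun n => eval g d n >>= eval g c
  | prec c d => fun p =>
      p.unpair.2.rec (eval g c p.unpair.1) fun y IH => do
        let i ← IH
        eval g d (Nat.pair p.unpair.1 (Nat.pair y i))
  | rfind c => fun a => Nat.rfind fun n => (fun m => decide (m = 0)) <$> eval g c (Nat.pair a n)

/-- The index (Gödel number) of a program. Every natural number is the index of exactly one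
program. -/
def index : OracleCode → ℕ
  | zero => 0
  | succ => 1
  | left => 2
  | right => 3
  | oracle => 4
  | pair c d => 4 * Nat.pair c.index d.index + 5
  | comp c d => 4 * Nat.pair c.index d.index + 6
  | prec c d => 4 * Nat.pair c.index d.index + 7
  | rfind c => 4 * c.index + 8

theorem index_bijective : Function.Bijective index := by
  constructor
  · intro c
    induction c with
    | zero | succ | left | right | oracle =>
      intro d h
      cases d <;> simp only [index] at h <;> first | rfl | omega
    | pair a b iha ihb | comp a b iha ihb | prec a b iha ihb =>
      intro d h
      cases d <;> simp only [index] at h <;> try omega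
      rename_i p q
      have h' := Nat.pair_eq_pair.1
        (by omega : Nat.pair a.index b.index = Nat.pair p.index q.index)
      rw [iha h'.1, ihb h'.2]
    | rfind a iha =>
      intro d h
      cases d <;> simp only [index] at h <;> try omega
      rename_i p
      rw [iha (by omega : a.index = p.index)]
  · intro n
    induction n using Nat.strong_induction_on with
    | _ n ih =>
      by_cases hn : n < 5
      · interval_cases n
        exacts [⟨zero, rfl⟩, ⟨succ, rfl⟩, ⟨left, rfl⟩, ⟨right, rfl⟩, ⟨oracle, rfl⟩]
      · obtain ⟨q, r, hr, rfl⟩ : ∃ q r, r < 4 ∧ n = 4 * q + 5 + r :=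
          ⟨(n - 5) / 4, (n - 5) % 4, by omega, by omega⟩
        have h1 := Nat.unpair_left_le q
        have h2 := Nat.unpair_right_le q
        obtain ⟨c, hc⟩ := ih q.unpair.1 (by omega)
        obtain ⟨d, hd⟩ := ih q.unpair.2 (by omega)
        obtain ⟨e, he⟩ := ih q (by omega)
        interval_cases r
        · exact ⟨pair c d, by simp [index, hc, hd]⟩
        · exact ⟨comp c d, by simp [index, hc, hd]⟩
        · exact ⟨prec c d, by simp [index, hc, hd]⟩
        · exact ⟨rfind e, by simp [index, he]⟩

end OracleCode

/-- The Turing jump `A'`: the set of all `e` such that the `e`-th program with oracle `A` halts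
on input `e`. -/
def jump (A : Set ℕ) : Set ℕ :=
  {e | ∃ c : OracleCode, c.index = e ∧ (c.eval (charFun A) e).Dom}

/-- A degree is computably enumerable if it contains a computably enumerable set. -/
def IsCEDegree (a : TuringDegree) : Prop :=
  ∃ W : Set ℕ, REPred (fun n => n ∈ W) ∧ deg W = a

/-- A degree is low if it contains a set `A` with `A' ≡_T ∅'`. -/
def IsLowDegree (a : TuringDegree) : Prop :=
  ∃ A : Set ℕ, deg A = a ∧ deg (jump A) = deg (jump ∅)

/-! ### Oracle Turing machines and their running time -/

/-- A multitape oracle Turing machine, in Mathlib's model `Turing.TM2` (finitely many stacks, a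
tape being a pair of stacks), with finite alphabet, label set and set of internal states.
At a label `l` the machine either performs an ordinary instruction (`Sum.inl`) or asks the oracle
about the string written on its query tape and continues at the label `next b`, where `b` is the
answer (`Sum.inr next`). Output `1` or `0` is given through the internal state at the time of
halting. -/
structure OracleTM where
  /-- the stacks -/
  K : Type
  /-- the tape alphabet -/
  Γ : Type
  /-- the labels of the program -/
  Λ : Type
  /-- the internal states -/
  σ : Type
  [decK : DecidableEq K]
  [finK : Finite K]
  [finΓ : Finite Γ]
  [finΛ : Finite Λ]
  [finσ : Finite σ]
  /-- the input tape -/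
  inputTape : K
  /-- the query tape -/
  queryTape : K
  input_ne_query : inputTape ≠ queryTape
  /-- the symbols `0` and `1` of the alphabet -/
  bit : Bool ↪ Γ
  /-- the label at which the computation starts -/
  start : Λ
  /-- the initial internal state -/
  init : σ
  /-- the program -/
  prog : Λ → Turing.TM2.Stmt (fun _ : K => Γ) Λ σ ⊕ (Bool → Λ)
  /-- the output in a halting configuration -/
  out : σ → Bool

namespace OracleTM

attribute [instance] decK

variable (M : OracleTM)

/-- Configurations; the machine has halted when the label is `none`. -/
abbrev Cfg : Type :=
  Turing.TM2.Cfg (fun _ : M.K => M.Γ) M.Λ M.σ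

/-- The start configuration on input `x`: the first symbol of `x` is on top of the input stack,
all other stacks are empty. -/
def initCfg (x : List Bool) : M.Cfg where
  l := some M.start
  var := M.init
  stk := Function.update (fun _ => []) M.inputTape (x.map M.bit)

open Classical in
/-- The answer of the oracle `A` when the query stack is `q`. The query string is read in the
order in which it was pushed. A stack that holds anything but a binary string gets the
answer "no". -/
noncomputable def answer (A : Set ℕ) (q : List M.Γ) : Bool :=
  decide (∃ y : List Bool, q.reverse = y.map M.bit ∧ strNum y ∈ A)

/-- One step of the computation with oracle `A`; a query takes one step. Halting configurations
are left unchanged. -/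
noncomputable def step (A : Set ℕ) : M.Cfg → M.Cfg
  | ⟨none, v, S⟩ => ⟨none, v, S⟩
  | ⟨some l, v, S⟩ =>
    match M.prog l with
    | Sum.inl s => Turing.TM2.stepAux s v S
    | Sum.inr next => ⟨some (next (M.answer A (S M.queryTape))), v, S⟩

/-- The configuration after `t` steps of the computation on input `x` with oracle `A`. -/
noncomputable def run (A : Set ℕ) (x : List Bool) (t : ℕ) : M.Cfg :=
  (M.step A)^[t] (M.initCfg x)

/-- `M` with oracle `A` decides the language `L` in time `f`: on every input `x` it halts within
`f x` steps with the correct output. -/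
def DecidesInTime (A : Set ℕ) (L : Set (List Bool)) (f : List Bool → ℕ) : Prop :=
  ∀ x, (M.run A x (f x)).l = none ∧ (M.out (M.run A x (f x)).var = true ↔ x ∈ L)

/-- A machine without oracle: the program contains no query. -/
def OracleFree : Prop :=
  ∀ l, (M.prog l).isLeft = true

end OracleTM

/-- `A` is low for speed: if a computable language is decided in time `f` by a machine with oracle
`A`, then it is decided in time `p ∘ f`, for some polynomial `p`, by a machine without oracle. -/
def LowForSpeed (A : Set ℕ) : Prop :=
  ∀ (L : Set (List Bool)) (f : List Bool → ℕ), ComputablePred (fun x => x ∈ L) →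
    (∃ M : OracleTM, M.DecidesInTime A L f) →
    ∃ (M : OracleTM) (p : Polynomial ℕ),
      M.OracleFree ∧ M.DecidesInTime ∅ L (fun x => p.eval (f x))

/-- The set of Turing degrees that contain a low for speed set. -/
def LFSDegrees : Set TuringDegree :=
  {a | ∃ X : Set ℕ, deg X = a ∧ LowForSpeed X}

end LowSpeed

namespace LowSpeed

open Encodable

/-! ### Binary strings and numbers -/

/-! Suppose that `X` in the degree is low for speed, that `W` is a c.e. set of the same degree, the
domain of a code `c`, and that `A` in the degree is low. If `W` were not computable, a properly `Π₂`
predicate, `IsTotalOn`, would become `Σ₂`.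

For each `k` consider the language of pairs `(n, m)` such that `n` enters `W` after stage `m`, at a
stage by which `k` has not yet been seen to be total up to `m` (`LatePair`). If `k` is total, the
language is computable: wait until totality up to `m` is confirmed; only the stages before that
matter (`computablePred_latePair`). If totality of `k` fails at `m`, confirmation up to `m` never
arrives, so column `m` is `W` minus what was enumerated by stage `m`, and the language computes `W`
(`computablePred_dom_of_latePair`). So, for noncomputable `W`, the `k`-th language is computable
exactly when `k` is total. An oracle for `X` decides all these languages uniformly, by a single
machine `M` that reads `k` in unary at the front of its input.

For total `k`, lowness for speed applies to `M` restricted to the prefix of `k` and yields an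
oracle-free machine with only polynomial slowdown. Cut off after polynomially many steps, it is a
primitive recursive function of the input and the time budget, hence has an index `d` in a
computable list of total functions. The relation `Simulates` says of `d` that it answers correctly
within the budget given by the running time of `M`, and never wrongly (`exists_simulates`).
Conversely, any such `d` makes the language computable (`Simulates.computablePred`), so `k` is
total.

The speed bound keeps the complexity low. Mere computability of the language would involve a search
for halting times. With the time of `M` as budget and total functions as candidates, a failure of
`Simulates` is a finite event decidable in `X`. Thus `∃ d, Simulates …` is `Σ₂` relative to `X`,
and, as `A` is low, it is `Σ₂` outright (`isSigmaTwo_of_low`). This contradicts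
`not_isSigmaTwo_isTotalOn`. -/

theorem strNum_concat (x : List Bool) (b : Bool) :
    strNum (x ++ [b]) = 2 * strNum x + 1 + b.toNat := by
  simp [strNum]

theorem strNum_injective : Function.Injective strNum := by
  intro x
  induction x using List.reverseRecOn with
  | nil =>
    intro y h
    induction y using List.reverseRecOn with
    | nil => rfl
    | append_singleton y b _ =>
      have h' := h.trans (strNum_concat y b)
      simp [strNum] at h'
      omega
  | append_singleton x b ih =>
    intro y h
    induction y using List.reverseRecOn with
    | nil =>
      rw [strNum_concat] at h
      simp [strNum] at h
    | append_singleton y c _ =>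
      rw [strNum_concat, strNum_concat] at h
      have hb : b = c := by
        cases b <;> cases c <;> simp at h <;> first | rfl | omega
      subst hb
      rw [ih (by omega : strNum x = strNum y)]

theorem strNum_surjective : Function.Surjective strNum := by
  intro n
  induction n using Nat.strong_induction_on with
  | _ n ih =>
    rcases Nat.eq_zero_or_pos n with rfl | hn
    · exact ⟨[], rfl⟩
    · obtain ⟨x, hx⟩ := ih ((n - 1) / 2) (by omega)
      rcases Nat.mod_two_eq_zero_or_one (n - 1) with h | h
      · exact ⟨x ++ [false], by rw [strNum_concat, hx]; simp; omega⟩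
      · exact ⟨x ++ [true], by rw [strNum_concat, hx]; simp; omega⟩

/-- The inverse of `strNum`. -/
noncomputable def numStr : ℕ → List Bool :=
  (Equiv.ofBijective strNum ⟨strNum_injective, strNum_surjective⟩).symm

@[simp] theorem strNum_numStr (n : ℕ) : strNum (numStr n) = n :=
  (Equiv.ofBijective strNum ⟨strNum_injective, strNum_surjective⟩).apply_symm_apply n

@[simp] theorem numStr_strNum (x : List Bool) : numStr (strNum x) = x :=
  (Equiv.ofBijective strNum ⟨strNum_injective, strNum_surjective⟩).symm_apply_apply x

theorem primrec_strNum : Primrec strNum :=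
  Primrec.list_foldl Primrec.id (Primrec.const 0)
    ((Primrec.nat_add.comp
      (Primrec.succ.comp (Primrec.nat_mul.comp (Primrec.const 2) (Primrec.fst.comp Primrec.snd)))
      ((Primrec.dom_bool Bool.toNat).comp (Primrec.snd.comp Primrec.snd))).to₂)

/-- The inverse of a computable bijection is computable. -/
theorem computable_of_leftInverse {α β : Type*} [Primcodable α] [Primcodable β] [DecidableEq β]
    {f : α → β} {g : β → α}
    (hf : Computable f) (h1 : ∀ a, g (f a) = a) (h2 : ∀ b, f (g b) = b) : Computable g := by
  have hp : Computable₂ fun (b : β) (k : ℕ) =>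
      (decode (α := α) k).bind fun a => bif decide (f a = b) then some a else none := by
    refine Computable.option_bind (Computable.decode.comp Computable.snd) ?_
    refine Computable.cond ?_ (Computable.option_some.comp Computable.snd) (Computable.const none)
    exact (Primrec.eq.decide.to_comp).comp (hf.comp Computable.snd)
      (Computable.fst.comp Computable.fst)
  refine (Partrec.rfindOpt hp).of_eq_tot fun b => ?_
  have hdom : (Nat.rfindOpt fun k => (decode (α := α) k).bind fun a =>
      bif decide (f a = b) then some a else none).Dom := by
    rw [Nat.rfindOpt_dom]
    exact ⟨encode (g b), g b, by simp [h2]⟩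
  obtain ⟨a, ha⟩ := Part.dom_iff_mem.1 hdom
  obtain ⟨k, hk⟩ := Nat.rfindOpt_spec ha
  obtain ⟨a', -, h⟩ := Option.mem_bind_iff.1 hk
  by_cases hab : f a' = b
  · simp [hab] at h
    have : g b = a := by rw [← hab, h1, h]
    rw [this]
    exact ha
  · simp [hab] at h

theorem computable_numStr : Computable numStr :=
  computable_of_leftInverse primrec_strNum.to_comp numStr_strNum strNum_numStr

/-! ### Initial segments of an oracle and the use principle -/

open Classical in
/-- The answers of the oracle `X` to the first `b` queries. -/
noncomputable def initSeg (X : Set ℕ) (b : ℕ) : List Bool :=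
  (List.range b).map fun n => decide (n ∈ X)

@[simp] theorem length_initSeg (X : Set ℕ) (b : ℕ) : (initSeg X b).length = b := by
  simp [initSeg]

open Classical in
theorem initSeg_succ (X : Set ℕ) (b : ℕ) :
    initSeg X (b + 1) = initSeg X b ++ [decide (b ∈ X)] := by
  simp [initSeg, List.range_succ]

theorem take_initSeg (X : Set ℕ) {b c : ℕ} (h : b ≤ c) :
    (initSeg X c).take b = initSeg X b := by
  simp [initSeg, ← List.map_take, List.take_range, h]

theorem initSeg_prefix (X : Set ℕ) {b c : ℕ} (h : b ≤ c) : initSeg X b <+: initSeg X c := by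
  rw [← take_initSeg X h]
  exact List.take_prefix _ _

open Classical in
theorem getElem?_initSeg (X : Set ℕ) (b n : ℕ) :
    (initSeg X b)[n]? = if n < b then some (decide (n ∈ X)) else none := by
  by_cases h : n < b <;> simp [initSeg, h]

/-- `F` computes `f` from initial segments of `X`. -/
structure IsFunctional (X : Set ℕ) (F : List Bool → ℕ → Part ℕ) (f : ℕ → Part ℕ) : Prop where
  partrec : Partrec₂ F
  mono : ∀ {σ τ : List Bool} {n v : ℕ}, σ <+: τ → v ∈ F σ n → v ∈ F τ n
  mem_iff : ∀ {n v : ℕ}, v ∈ f n ↔ ∃ b, v ∈ F (initSeg X b) n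

theorem IsFunctional.mono_initSeg {X : Set ℕ} {F : List Bool → ℕ → Part ℕ} {f : ℕ → Part ℕ}
    (h : IsFunctional X F f) {b c n v : ℕ} (hbc : b ≤ c) (hv : v ∈ F (initSeg X b) n) :
    v ∈ F (initSeg X c) n :=
  h.mono (initSeg_prefix X hbc) hv

theorem isFunctional_of_partrec (X : Set ℕ) {f : ℕ →. ℕ} (hf : Nat.Partrec f) :
    IsFunctional X (fun _ => f) f where
  partrec := (Partrec.nat_iff.2 hf).comp Computable.snd
  mono := fun _ h => h
  mem_iff := by simp

/-- A convergent computation consults only finitely many values of the oracle. Because functionals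
are monotone in the segment, the segments needed by several subcomputations can be replaced by the
longest one. -/
theorem exists_isFunctional {X : Set ℕ} {f : ℕ →. ℕ}
    (hf : Nat.RecursiveIn {(charFun X : ℕ →. ℕ)} f) : ∃ F, IsFunctional X F f := by
  classical
  induction hf with
  | zero => exact ⟨_, isFunctional_of_partrec X .zero⟩
  | succ => exact ⟨_, isFunctional_of_partrec X .succ⟩
  | left => exact ⟨_, isFunctional_of_partrec X .left⟩
  | right => exact ⟨_, isFunctional_of_partrec X .right⟩
  | oracle g hg =>
    obtain rfl : g = _ := hg
    -- A query beyond the end of the segment diverges; answering it by a default would destroy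
    -- monotonicity.
    refine ⟨fun σ n => (σ[n]?.map Bool.toNat : Option ℕ), ?_, ?_, ?_⟩
    · exact (Primrec.option_map Primrec.list_getElem?
        ((Primrec.dom_bool Bool.toNat).comp Primrec.snd).to₂).to_comp.ofOption
    · rintro σ τ n v ⟨ρ, rfl⟩ h
      simp only [Part.mem_ofOption, Option.mem_def, Option.map_eq_some_iff] at h ⊢
      obtain ⟨a, ha, rfl⟩ := h
      exact ⟨a, by rw [List.getElem?_append_left (List.getElem?_eq_some_iff.1 ha).1, ha], rfl⟩
    · intro n v
      simp only [Part.mem_ofOption, Option.mem_def, getElem?_initSeg]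
      constructor
      · intro h
        have h : v = charFun X n := by simpa using h
        refine ⟨n + 1, ?_⟩
        subst h
        by_cases hn : n ∈ X <;> simp [charFun, hn]
      · rintro ⟨b, h⟩
        by_cases hb : n < b
        · simp only [hb, if_true, Option.map_some, Option.some.injEq] at h
          subst h
          by_cases hn : n ∈ X <;> simp [charFun, hn]
        · simp [hb] at h
  | @pair f g _ _ ihf ihg =>
    obtain ⟨F, hF⟩ := ihf
    obtain ⟨G, hG⟩ := ihg
    have key : ∀ (p q : Part ℕ) (v : ℕ), v ∈ (Nat.pair <$> p <*> q) ↔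
        ∃ a ∈ p, ∃ b ∈ q, Nat.pair a b = v := by
      intro p q v
      simp [Seq.seq, Part.map_eq_map, Part.mem_bind_iff, Part.mem_map_iff]
    refine ⟨fun σ n => Nat.pair <$> F σ n <*> G σ n, ?_, ?_, ?_⟩
    · refine (hF.partrec.bind (g := fun p a => (G p.1 p.2).map (Nat.pair a))
        (Partrec.map (hG.partrec.comp (Computable.fst.comp Computable.fst)
          (Computable.snd.comp Computable.fst))
          (Primrec₂.natPair.to_comp.comp (Computable.snd.comp Computable.fst)
            Computable.snd).to₂)).of_eq ?_
      intro p
      ext v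
      rw [key]
      simp [Part.mem_bind_iff, Part.mem_map_iff]
    · intro σ τ n v h hv
      rw [key] at hv ⊢
      obtain ⟨a, ha, b, hb, rfl⟩ := hv
      exact ⟨a, hF.mono h ha, b, hG.mono h hb, rfl⟩
    · intro n v
      simp only [key, hF.mem_iff, hG.mem_iff]
      constructor
      · rintro ⟨a, ⟨b, ha⟩, a', ⟨b', hb⟩, rfl⟩
        exact ⟨max b b', a, hF.mono_initSeg (le_max_left _ _) ha, a',
          hG.mono_initSeg (le_max_right _ _) hb, rfl⟩
      · rintro ⟨b, a, ha, a', ha', rfl⟩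
        exact ⟨a, ⟨b, ha⟩, a', ⟨b, ha'⟩, rfl⟩
  | @comp f g _ _ ihf ihg =>
    obtain ⟨F, hF⟩ := ihf
    obtain ⟨G, hG⟩ := ihg
    refine ⟨fun σ n => (G σ n).bind (F σ), ?_, ?_, ?_⟩
    · exact hG.partrec.bind (hF.partrec.comp (Computable.fst.comp Computable.fst)
        Computable.snd).to₂
    · intro σ τ n v h hv
      obtain ⟨a, ha, hv⟩ := Part.mem_bind_iff.1 hv
      exact Part.mem_bind_iff.2 ⟨a, hG.mono h ha, hF.mono h hv⟩
    · intro n v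
      refine Part.mem_bind_iff.trans (Iff.trans ?_ (exists_congr fun b => Part.mem_bind_iff).symm)
      simp only [hF.mem_iff, hG.mem_iff]
      constructor
      · rintro ⟨a, ⟨b, ha⟩, b', hb⟩
        exact ⟨max b b', a, hG.mono_initSeg (le_max_left _ _) ha,
          hF.mono_initSeg (le_max_right _ _) hb⟩
      · rintro ⟨b, a, ha, hv⟩
        exact ⟨a, ⟨b, ha⟩, b, hv⟩
  | @prec f g _ _ ihf ihg =>
    obtain ⟨F, hF⟩ := ihf
    obtain ⟨G, hG⟩ := ihg
    let H : List Bool → ℕ → ℕ →. ℕ := fun σ a n =>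
      n.rec (F σ a) fun y IH => IH.bind fun i => G σ (Nat.pair a (Nat.pair y i))
    have Hmono : ∀ {σ τ : List Bool}, σ <+: τ → ∀ {a n v : ℕ}, v ∈ H σ a n → v ∈ H τ a n := by
      intro σ τ h a n
      induction n with
      | zero => exact fun hv => hF.mono h hv
      | succ n ih =>
        intro v hv
        simp only [H, Part.mem_bind_iff] at hv ⊢
        obtain ⟨i, hi, hv⟩ := hv
        exact ⟨i, ih hi, hG.mono h hv⟩
    refine ⟨fun σ p => H σ p.unpair.1 p.unpair.2, ?_, fun h => Hmono h, ?_⟩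
    · refine Partrec.nat_rec (Computable.snd.comp (Computable.unpair.comp Computable.snd))
        (hF.partrec.comp Computable.fst
          (Computable.fst.comp (Computable.unpair.comp Computable.snd)))
        (hG.partrec.comp (Computable.fst.comp Computable.fst)
          (Primrec₂.natPair.to_comp.comp
            (Computable.fst.comp (Computable.unpair.comp (Computable.snd.comp Computable.fst)))
            (Primrec₂.natPair.to_comp.comp (Computable.fst.comp Computable.snd)
              (Computable.snd.comp Computable.snd)))).to₂
    · intro p v
      dsimp only
      induction p.unpair.2 generalizing v with
      | zero => exact hF.mem_iff
      | succ n ih =>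
        simp only [H, Part.bind_eq_bind, Part.mem_bind_iff] at ih ⊢
        constructor
        · rintro ⟨i, hi, hv⟩
          obtain ⟨b, hi⟩ := ih.1 hi
          obtain ⟨b', hv⟩ := hG.mem_iff.1 hv
          exact ⟨max b b', i, Hmono (initSeg_prefix X (le_max_left b b')) hi,
            hG.mono_initSeg (le_max_right _ _) hv⟩
        · rintro ⟨b, i, hi, hv⟩
          exact ⟨i, ih.2 ⟨b, hi⟩, hG.mem_iff.2 ⟨b, hv⟩⟩
  | @rfind f _ ihf =>
    obtain ⟨F, hF⟩ := ihf
    have key : ∀ (p : ℕ → Part ℕ) (v : ℕ),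
        v ∈ Nat.rfind (fun n => (p n).map fun m => decide (m = 0)) ↔
          0 ∈ p v ∧ ∀ m < v, ∃ i ∈ p m, i ≠ 0 := by
      intro p v
      refine Nat.mem_rfind.trans ?_
      simp [Part.mem_map_iff]
    refine ⟨fun σ a => Nat.rfind fun n => (F σ (Nat.pair a n)).map fun m => decide (m = 0),
      ?_, ?_, ?_⟩
    · refine Partrec.rfind (p := fun (q : List Bool × ℕ) n =>
        (F q.1 (Nat.pair q.2 n)).map fun m => decide (m = 0)) ?_
      exact Partrec.map (hF.partrec.comp (Computable.fst.comp Computable.fst)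
        (Primrec₂.natPair.to_comp.comp (Computable.snd.comp Computable.fst) Computable.snd))
        ((Primrec.eq.decide.comp Primrec.snd (Primrec.const 0)).to_comp).to₂
    · intro σ τ n v h hv
      replace hv := (key _ _).1 hv
      refine (key _ _).2 ⟨hF.mono h hv.1, fun m hm => ?_⟩
      obtain ⟨i, hi, h0⟩ := hv.2 m hm
      exact ⟨i, hF.mono h hi, h0⟩
    · intro n v
      refine (key (fun m => f (Nat.pair n m)) v).trans
        (Iff.trans ?_ (exists_congr fun b => key _ _).symm)
      simp only [hF.mem_iff]
      constructor
      · rintro ⟨⟨b, h0⟩, h⟩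
        -- Each of the finitely many rejected candidates has its own use; the supremum of these
        -- serves for all of them.
        have : ∀ m, ∃ b, m < v → ∃ i ∈ F (initSeg X b) (Nat.pair n m), i ≠ 0 := by
          intro m
          by_cases hm : m < v
          · obtain ⟨i, ⟨b, hb⟩, hi⟩ := h m hm
            exact ⟨b, fun _ => ⟨i, hb, hi⟩⟩
          · exact ⟨0, fun h => absurd h hm⟩
        choose B hB using this
        refine ⟨max b ((Finset.range v).sup B), hF.mono_initSeg (le_max_left _ _) h0, ?_⟩
        intro m hm
        obtain ⟨i, hi, h0⟩ := hB m hm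
        exact ⟨i, hF.mono_initSeg (le_max_of_le_right
          (Finset.le_sup (f := B) (Finset.mem_range.2 hm))) hi, h0⟩
      · rintro ⟨b, h0, h⟩
        refine ⟨⟨b, h0⟩, fun m hm => ?_⟩
        obtain ⟨i, hi, h0⟩ := h m hm
        exact ⟨i, ⟨b, hi⟩, h0⟩

/-- A function recursive in `X` is computed by a primitive recursive search through the initial
segments of `X`. -/
theorem exists_primrec_search {X : Set ℕ} {f : ℕ →. ℕ}
    (hf : Nat.RecursiveIn {(charFun X : ℕ →. ℕ)} f) :
    ∃ ρ : List Bool → ℕ → Option ℕ, Primrec₂ ρ ∧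
      ∀ n v, v ∈ f n ↔ ∃ b, ρ (initSeg X b) n = some v := by
  obtain ⟨F, hF⟩ := exists_isFunctional hf
  have hF' := hF.partrec
  obtain ⟨c, hc⟩ := Nat.Partrec.Code.exists_code.1 hF'
  have hc' : ∀ σ n, c.eval (encode (σ, n)) = F σ n := by
    intro σ n
    rw [hc]
    simp [Part.map_id' (f := (encode : ℕ → ℕ)) (fun _ => rfl)]
  -- The length of the segment codes a pair: how much of the segment to consult and for how many
  -- steps to run. A single existential quantifier over `b` then covers both.
  refine ⟨fun σ n => Nat.Partrec.Code.evaln (Nat.unpair σ.length).2 c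
    (encode (σ.take (Nat.unpair σ.length).1, n)), ?_, ?_⟩
  · refine Nat.Partrec.Code.primrec_evaln.comp (Primrec.pair (Primrec.pair
      (Primrec.snd.comp (Primrec.unpair.comp (Primrec.list_length.comp Primrec.fst)))
      (Primrec.const c)) (Primrec.encode.comp (Primrec.pair (Primrec.list_take.comp
        (Primrec.fst.comp (Primrec.unpair.comp (Primrec.list_length.comp Primrec.fst)))
        Primrec.fst) Primrec.snd)))
  · intro n v
    rw [hF.mem_iff]
    simp only [length_initSeg, take_initSeg X (Nat.unpair_left_le _)]
    constructor
    · rintro ⟨b, hb⟩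
      rw [← hc', Nat.Partrec.Code.evaln_complete] at hb
      obtain ⟨k, hk⟩ := hb
      exact ⟨Nat.pair b k, by simpa using hk⟩
    · rintro ⟨b, hb⟩
      exact ⟨_, hc' _ _ ▸ Nat.Partrec.Code.evaln_sound hb⟩

/-! ### `Σ₂` predicates -/

/-- `P` is a `Σ₂` predicate. -/
def IsSigmaTwo {α : Type*} [Primcodable α] (P : α → Prop) : Prop :=
  ∃ R : α × ℕ × ℕ → Prop, PrimrecPred R ∧ ∀ a, P a ↔ ∃ v, ∀ w, R (a, v, w)

namespace IsSigmaTwo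

variable {α β : Type*} [Primcodable α] [Primcodable β]

theorem of_eq {P Q : α → Prop} (hP : IsSigmaTwo P) (h : ∀ a, P a ↔ Q a) : IsSigmaTwo Q :=
  (funext fun a => propext (h a) : P = Q) ▸ hP

theorem of_primrecPred {P : α → Prop} (hP : PrimrecPred P) : IsSigmaTwo P :=
  ⟨fun p => P p.1, hP.comp Primrec.fst, fun a => by simp⟩

theorem comp {P : β → Prop} (hP : IsSigmaTwo P) {f : α → β} (hf : Primrec f) :
    IsSigmaTwo fun a => P (f a) := by
  obtain ⟨R, hR, h⟩ := hP
  exact ⟨fun p => R (f p.1, p.2), hR.comp (Primrec.pair (hf.comp Primrec.fst) Primrec.snd),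
    fun a => h (f a)⟩

theorem and {P Q : α → Prop} (hP : IsSigmaTwo P) (hQ : IsSigmaTwo Q) :
    IsSigmaTwo fun a => P a ∧ Q a := by
  obtain ⟨R, hR, h⟩ := hP
  obtain ⟨S, hS, h'⟩ := hQ
  have hv : Primrec fun p : α × ℕ × ℕ => p.2.1.unpair :=
    Primrec.unpair.comp (Primrec.fst.comp Primrec.snd)
  have hw : Primrec fun p : α × ℕ × ℕ => p.2.2 := Primrec.snd.comp Primrec.snd
  refine ⟨fun p => R (p.1, p.2.1.unpair.1, p.2.2) ∧ S (p.1, p.2.1.unpair.2, p.2.2),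
    (hR.comp (Primrec.fst.pair ((Primrec.fst.comp hv).pair hw))).and
      (hS.comp (Primrec.fst.pair ((Primrec.snd.comp hv).pair hw))), fun a => ?_⟩
  dsimp only
  rw [h, h']
  constructor
  · rintro ⟨⟨v, hv⟩, v', hv'⟩
    exact ⟨Nat.pair v v', fun w => by simpa using ⟨hv w, hv' w⟩⟩
  · rintro ⟨v, hv⟩
    exact ⟨⟨_, fun w => (hv w).1⟩, _, fun w => (hv w).2⟩

theorem exists_nat {P : α × ℕ → Prop} (hP : IsSigmaTwo P) : IsSigmaTwo fun a => ∃ n, P (a, n) := by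
  obtain ⟨R, hR, h⟩ := hP
  have hv : Primrec fun p : α × ℕ × ℕ => p.2.1.unpair :=
    Primrec.unpair.comp (Primrec.fst.comp Primrec.snd)
  refine ⟨fun p => R ((p.1, p.2.1.unpair.1), p.2.1.unpair.2, p.2.2),
    hR.comp ((Primrec.fst.pair (Primrec.fst.comp hv)).pair
      ((Primrec.snd.comp hv).pair (Primrec.snd.comp Primrec.snd))), fun a => ?_⟩
  simp only [h]
  constructor
  · rintro ⟨n, v, hv⟩
    exact ⟨Nat.pair n v, fun w => by simpa using hv w⟩
  · rintro ⟨v, hv⟩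
    exact ⟨_, _, hv⟩

theorem exists_encodable {P : α × β → Prop} (hP : IsSigmaTwo P) :
    IsSigmaTwo fun a => ∃ b, P (a, b) := by
  obtain ⟨R, hR, h⟩ := hP
  have hR' : IsSigmaTwo fun p : α × ℕ => ∃ b, decode (α := β) p.2 = some b ∧ P (p.1, b) := by
    obtain ⟨_, hR⟩ := hR
    refine ⟨fun p =>
        ((decode (α := β) p.1.2).map fun b => decide (R ((p.1.1, b), p.2))) = some true,
      Primrec.eq.comp (Primrec.option_map (Primrec.decode.comp (Primrec.snd.comp Primrec.fst))
        (hR.comp (((Primrec.fst.comp (Primrec.fst.comp Primrec.fst)).pair Primrec.snd).pair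
          (Primrec.snd.comp Primrec.fst))).to₂) (Primrec.const _), fun a => ?_⟩
    cases hd : decode (α := β) a.2 <;> simp [h, hd]
  refine hR'.exists_nat.of_eq fun a => ⟨?_, ?_⟩
  · rintro ⟨n, b, -, hb⟩
    exact ⟨b, hb⟩
  · rintro ⟨b, hb⟩
    exact ⟨encode b, b, encodek b, hb⟩

/-- The witnesses for the finitely many `i` are gathered in one coded list, so the bounded
quantifier moves inside the existential one and joins the universal one. -/
theorem forall_lt {P : α × ℕ → Prop} (hP : IsSigmaTwo P) :
    IsSigmaTwo fun p : α × ℕ => ∀ i < p.2, P (p.1, i) := by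
  obtain ⟨R, hR, h⟩ := hP
  have hl : Primrec fun q : ℕ × ((α × ℕ) × ℕ × ℕ) =>
      (Denumerable.ofNat (List ℕ) q.2.2.1).getD q.1 0 :=
    (Primrec.list_getD 0).comp ((Primrec.ofNat (List ℕ)).comp
      (Primrec.fst.comp (Primrec.snd.comp Primrec.snd))) Primrec.fst
  have hS : PrimrecRel fun (i : ℕ) (q : (α × ℕ) × ℕ × ℕ) =>
      R ((q.1.1, i), (Denumerable.ofNat (List ℕ) q.2.1).getD i 0, q.2.2) :=
    hR.comp (Primrec.pair (Primrec.pair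
      (Primrec.fst.comp (Primrec.fst.comp Primrec.snd)) Primrec.fst)
      (Primrec.pair hl (Primrec.snd.comp (Primrec.snd.comp Primrec.snd))))
  refine ⟨fun q => ∀ i ∈ List.range q.1.2,
    R ((q.1.1, i), (Denumerable.ofNat (List ℕ) q.2.1).getD i 0, q.2.2),
    hS.forall_mem_list.comp (Primrec.list_range.comp (Primrec.snd.comp Primrec.fst)) Primrec.id,
    fun p => ?_⟩
  simp only [h, List.mem_range]
  constructor
  · intro H
    have : ∀ i, ∃ v, i < p.2 → ∀ w, R ((p.1, i), v, w) := by
      intro i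
      by_cases hi : i < p.2
      · exact (H i hi).imp fun v hv _ => hv
      · exact ⟨0, fun h => absurd h hi⟩
    choose V hV using this
    refine ⟨encode ((List.range p.2).map V), fun w i hi => ?_⟩
    simpa [List.getD, hi] using hV i hi w
  · rintro ⟨v, hv⟩ i hi
    exact ⟨_, fun w => hv w i hi⟩

end IsSigmaTwo

/-- The functions with a `Σ₂` graph are closed under relative computability. -/
theorem isSigmaTwo_graph {g f : ℕ → Part ℕ} (hg : IsSigmaTwo fun p : ℕ × ℕ => p.2 ∈ g p.1)
    (hf : Nat.RecursiveIn {g} f) : IsSigmaTwo fun p : ℕ × ℕ => p.2 ∈ f p.1 := by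
  have tot : ∀ {f : ℕ → ℕ}, Primrec f →
      IsSigmaTwo fun p : ℕ × ℕ => p.2 ∈ (Part.some (f p.1) : Part ℕ) := fun hf =>
    (IsSigmaTwo.of_primrecPred (Primrec.eq.comp Primrec.snd (hf.comp Primrec.fst))).of_eq
      fun p => Part.mem_some_iff.symm
  have p1 : Primrec fun n : ℕ => n.unpair.1 := Primrec.fst.comp Primrec.unpair
  have p2 : Primrec fun n : ℕ => n.unpair.2 := Primrec.snd.comp Primrec.unpair
  induction hf with
  | zero => exact tot (Primrec.const 0)
  | succ => exact tot Primrec.succ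
  | left => exact tot p1
  | right => exact tot p2
  | oracle g' hg' =>
    obtain rfl : g' = g := hg'
    exact hg
  | @pair f h _ _ ihf ihh =>
    have e1 : Primrec fun q : (ℕ × ℕ) × ℕ × ℕ => (q.1.1, q.2.1) :=
      Primrec.pair (Primrec.fst.comp Primrec.fst) (Primrec.fst.comp Primrec.snd)
    have e2 : Primrec fun q : (ℕ × ℕ) × ℕ × ℕ => (q.1.1, q.2.2) :=
      Primrec.pair (Primrec.fst.comp Primrec.fst) (Primrec.snd.comp Primrec.snd)
    have e3 : PrimrecPred fun q : (ℕ × ℕ) × ℕ × ℕ => Nat.pair q.2.1 q.2.2 = q.1.2 :=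
      Primrec.eq.comp (Primrec₂.natPair.comp (Primrec.fst.comp Primrec.snd)
        (Primrec.snd.comp Primrec.snd)) (Primrec.snd.comp Primrec.fst)
    refine (((ihf.comp e1).and (ihh.comp e2)).and
      (IsSigmaTwo.of_primrecPred e3)).exists_encodable.of_eq fun p => ?_
    simp only [Seq.seq, Part.map_eq_map, Part.mem_bind_iff, Part.mem_map_iff, Prod.exists]
    constructor
    · rintro ⟨a, b, ⟨ha, hb⟩, h⟩
      exact ⟨_, ⟨a, ha, rfl⟩, b, hb, h⟩
    · rintro ⟨_, ⟨a, ha, rfl⟩, b, hb, h⟩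
      exact ⟨a, b, ⟨ha, hb⟩, h⟩
  | @comp f h _ _ ihf ihh =>
    have e1 : Primrec fun q : (ℕ × ℕ) × ℕ => (q.1.1, q.2) :=
      Primrec.pair (Primrec.fst.comp Primrec.fst) Primrec.snd
    have e2 : Primrec fun q : (ℕ × ℕ) × ℕ => (q.2, q.1.2) :=
      Primrec.pair Primrec.snd (Primrec.snd.comp Primrec.fst)
    exact ((ihh.comp e1).and (ihf.comp e2)).exists_encodable.of_eq fun p =>
      (Part.mem_bind_iff (f := h p.1) (g := f) (b := p.2)).symm
  | @prec f h _ _ ihf ihh =>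
    -- the list `l` holds the values of the recursion
    have get : ∀ {γ : Type} [Primcodable γ] {l : γ → List ℕ} {i : γ → ℕ}, Primrec l → Primrec i →
        Primrec fun q => (l q).getD (i q) 0 := fun hl hi => (Primrec.list_getD 0).comp hl hi
    have s0 : IsSigmaTwo fun q : (ℕ × ℕ) × List ℕ => q.2.getD 0 0 ∈ f q.1.1.unpair.1 :=
      ihf.comp (f := fun q : (ℕ × ℕ) × List ℕ => (q.1.1.unpair.1, q.2.getD 0 0))
        (Primrec.pair (p1.comp (Primrec.fst.comp Primrec.fst))
          (get Primrec.snd (Primrec.const 0)))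
    have s1 : IsSigmaTwo fun r : ((ℕ × ℕ) × List ℕ) × ℕ =>
        r.1.2.getD (r.2 + 1) 0 ∈
          h (Nat.pair r.1.1.1.unpair.1 (Nat.pair r.2 (r.1.2.getD r.2 0))) :=
      ihh.comp (f := fun r : ((ℕ × ℕ) × List ℕ) × ℕ =>
          (Nat.pair r.1.1.1.unpair.1 (Nat.pair r.2 (r.1.2.getD r.2 0)), r.1.2.getD (r.2 + 1) 0))
        (Primrec.pair (Primrec₂.natPair.comp
          (p1.comp (Primrec.fst.comp (Primrec.fst.comp Primrec.fst)))
          (Primrec₂.natPair.comp Primrec.snd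
            (get (Primrec.snd.comp Primrec.fst) Primrec.snd)))
          (get (Primrec.snd.comp Primrec.fst) (Primrec.succ.comp Primrec.snd)))
    have s2 : IsSigmaTwo fun q : (ℕ × ℕ) × List ℕ => ∀ i < q.1.1.unpair.2,
        q.2.getD (i + 1) 0 ∈ h (Nat.pair q.1.1.unpair.1 (Nat.pair i (q.2.getD i 0))) :=
      s1.forall_lt.comp (f := fun q : (ℕ × ℕ) × List ℕ => (q, q.1.1.unpair.2))
        (Primrec.pair Primrec.id (p2.comp (Primrec.fst.comp Primrec.fst)))
    have s3 : PrimrecPred fun q : (ℕ × ℕ) × List ℕ => q.2.getD q.1.1.unpair.2 0 = q.1.2 :=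
      Primrec.eq.comp (get Primrec.snd (p2.comp (Primrec.fst.comp Primrec.fst)))
        (Primrec.snd.comp Primrec.fst)
    refine ((s0.and s2).and (IsSigmaTwo.of_primrecPred s3)).exists_encodable.of_eq fun p => ?_
    obtain ⟨p, v⟩ := p
    dsimp only
    generalize p.unpair.1 = a
    generalize p.unpair.2 = n
    induction n generalizing v with
    | zero =>
      constructor
      · rintro ⟨l, ⟨h0, -⟩, rfl⟩
        exact h0
      · intro hv
        exact ⟨[v], ⟨hv, by simp⟩, rfl⟩
    | succ n ih =>
      refine Iff.trans ?_ Part.mem_bind_iff.symm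
      constructor
      · rintro ⟨l, ⟨h0, h1⟩, rfl⟩
        exact ⟨l.getD n 0, (ih _).1 ⟨l, ⟨h0, fun i hi => h1 i (by omega)⟩, rfl⟩, h1 n (by omega)⟩
      · rintro ⟨i, hi, hv⟩
        obtain ⟨l, ⟨h0, h1⟩, rfl⟩ := (ih _).2 hi
        -- The course of values up to `n`, extended by the new value `v`. The list `l` is read
        -- through `getD`, since it may be shorter or longer than needed.
        let l' := (List.range (n + 2)).map fun j => if j = n + 1 then v else l.getD j 0
        have hl' : ∀ j, j < n + 2 → l'.getD j 0 = if j = n + 1 then v else l.getD j 0 := by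
          intro j hj
          simp [l', List.getD, hj]
        refine ⟨l', ⟨?_, fun j hj => ?_⟩, ?_⟩
        · rw [hl' 0 (by omega)]
          simpa using h0
        · rw [hl' j (by omega), hl' (j + 1) (by omega), if_neg (by omega : j ≠ n + 1)]
          by_cases hjn : j = n
          · subst hjn
            simpa using hv
          · rw [if_neg (by omega)]
            exact h1 j (by omega)
        · rw [hl' _ (by omega)]
          simp
  | @rfind f _ ihf =>
    have s0 : IsSigmaTwo fun p : ℕ × ℕ => 0 ∈ f (Nat.pair p.1 p.2) :=
      ihf.comp (f := fun p : ℕ × ℕ => (Nat.pair p.1 p.2, 0))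
        (Primrec.pair (Primrec₂.natPair.comp Primrec.fst Primrec.snd) (Primrec.const 0))
    have s1 : IsSigmaTwo fun q : ((ℕ × ℕ) × ℕ) × ℕ => q.2 ∈ f (Nat.pair q.1.1.1 q.1.2) :=
      ihf.comp (f := fun q : ((ℕ × ℕ) × ℕ) × ℕ => (Nat.pair q.1.1.1 q.1.2, q.2))
        (Primrec.pair (Primrec₂.natPair.comp
          (Primrec.fst.comp (Primrec.fst.comp Primrec.fst))
          (Primrec.snd.comp Primrec.fst)) Primrec.snd)
    have s2 : PrimrecPred fun q : ((ℕ × ℕ) × ℕ) × ℕ => ¬ q.2 = 0 :=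
      (Primrec.eq.comp Primrec.snd (Primrec.const 0)).not
    -- As `f` may be partial, rejection of a candidate is expressed by the existence of a nonzero
    -- value. This is again `Σ₂`, and so is its bounded universal closure.
    have s3 := ((s1.and (IsSigmaTwo.of_primrecPred s2)).exists_nat.forall_lt).comp
      (f := fun p : ℕ × ℕ => (p, p.2)) (Primrec.pair Primrec.id Primrec.snd)
    refine (s0.and s3).of_eq fun p => ?_
    refine Iff.trans ?_ Nat.mem_rfind.symm
    simp [Part.map_eq_map, Part.mem_map_iff]

/-- The `Π₂` predicate that will be shown to be `Σ₂` under the hypotheses of the theorem. -/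
def IsTotalOn (k : ℕ) : Prop :=
  ∀ v, ((Denumerable.ofNat Nat.Partrec.Code k).eval (Nat.pair k v)).Dom

/-- Diagonalization: given a `Σ₂` definition with matrix `R`, let `c` on `(k, v)` search for `w`
with `¬ R (k, v, w)`. At `k = encode c`, totality says exactly that the `Σ₂` definition fails. Since
`k` is part of the input in `IsTotalOn`, no recursion theorem is needed. -/
theorem not_isSigmaTwo_isTotalOn : ¬ IsSigmaTwo IsTotalOn := by
  rintro ⟨R, ⟨_, hR⟩, h⟩
  have hp : Partrec fun p : ℕ => Nat.rfind fun w =>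
      (Part.some (!decide (R (p.unpair.1, p.unpair.2, w))) : Part Bool) := by
    refine Partrec.rfind (p := fun (p w : ℕ) =>
      (Part.some (!decide (R (p.unpair.1, p.unpair.2, w))) : Part Bool)) ?_
    exact (Primrec.not.comp (hR.comp (Primrec.pair
      (Primrec.fst.comp (Primrec.unpair.comp Primrec.fst))
      (Primrec.pair (Primrec.snd.comp (Primrec.unpair.comp Primrec.fst))
        Primrec.snd)))).to_comp.partrec
  obtain ⟨c, hc⟩ := Nat.Partrec.Code.exists_code.1 (Partrec.nat_iff.1 hp)
  have key : ∀ k v, (c.eval (Nat.pair k v)).Dom ↔ ∃ w, ¬ R (k, v, w) := by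
    intro k v
    rw [hc]
    refine Nat.rfind_dom'.trans ?_
    simp
  have h1 := h (encode c)
  simp only [IsTotalOn, Denumerable.ofNat_encode, key] at h1
  by_cases H : ∀ v, ∃ w, ¬ R (encode c, v, w)
  · obtain ⟨v, hv⟩ := h1.1 H
    obtain ⟨w, hw⟩ := H v
    exact hw (hv w)
  · push Not at H
    exact H.elim fun v hv => absurd (h1.2 ⟨v, hv⟩ v) (by simpa using hv)

/-! ### Translation of oracle programs into `Nat.Partrec.Code` -/

namespace OracleCode

open Nat.Partrec (Code)

/-- The program with a given index. -/
noncomputable def ofIndex : ℕ → OracleCode :=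
  (Equiv.ofBijective index index_bijective).symm

@[simp] theorem index_ofIndex (n : ℕ) : (ofIndex n).index = n :=
  (Equiv.ofBijective index index_bijective).apply_symm_apply n

@[simp] theorem ofIndex_index (c : OracleCode) : ofIndex c.index = c :=
  (Equiv.ofBijective index index_bijective).symm_apply_apply c

/-- Translation with the zero function as oracle; `r` gives the translation of `rfind`. -/
def toCode (r : Code → Code) : OracleCode → Code
  | zero => .zero
  | succ => .succ
  | left => .left
  | right => .right
  | oracle => .zero
  | pair c d => .pair (toCode r c) (toCode r d)
  | comp c d => .comp (toCode r c) (toCode r d)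
  | prec c d => .prec (toCode r c) (toCode r d)
  | rfind c => r (toCode r c)

/-- One step of the course-of-values recursion that computes `toCode r (ofIndex n)`, where `n` is
the length of `l`, from the list `l` of the previous values. -/
def toCodeStep (r : Code → Code) (l : List Code) : Option Code :=
  let q := (l.length - 5) / 4
  let m := (l.length - 5) % 4
  if l.length < 5 then
    some ([Code.zero, .succ, .left, .right, .zero].getD l.length .zero)
  else if m = 3 then l[q]?.map r
  else l[q.unpair.1]?.bind fun a => l[q.unpair.2]?.map fun b =>
    if m = 0 then .pair a b else if m = 1 then .comp a b else .prec a b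

theorem primrec_toCodeStep {r : Code → Code} (hr : Primrec r) : Primrec (toCodeStep r) := by
  have hn : Primrec fun l : List Code => l.length := Primrec.list_length
  have hn' : Primrec fun l : List Code => l.length - 5 := Primrec.nat_sub.comp hn (Primrec.const 5)
  have hq : Primrec fun l : List Code => (l.length - 5) / 4 :=
    Primrec.nat_div.comp hn' (Primrec.const 4)
  have hm : Primrec fun l : List Code => (l.length - 5) % 4 :=
    Primrec.nat_mod.comp hn' (Primrec.const 4)
  refine Primrec.ite (Primrec.nat_lt.comp hn (Primrec.const 5)) ?_
    (Primrec.ite (Primrec.eq.comp hm (Primrec.const 3)) ?_ ?_)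
  · exact Primrec.option_some.comp ((Primrec.list_getD _).comp (Primrec.const _) hn)
  · exact Primrec.option_map (Primrec.list_getElem?.comp Primrec.id hq) (hr.comp Primrec.snd).to₂
  · refine Primrec.option_bind (Primrec.list_getElem?.comp Primrec.id
      (Primrec.fst.comp (Primrec.unpair.comp hq))) ?_
    refine Primrec.option_map (Primrec.list_getElem?.comp Primrec.fst
      (Primrec.snd.comp (Primrec.unpair.comp (hq.comp Primrec.fst)))) ?_
    have ha : Primrec fun p : (List Code × Code) × Code => p.1.2 := Primrec.snd.comp Primrec.fst
    have hb : Primrec fun p : (List Code × Code) × Code => p.2 := Primrec.snd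
    have hm' := hm.comp
      (Primrec.fst.comp (Primrec.fst : Primrec fun p : (List Code × Code) × Code => p.1))
    exact Primrec.ite (Primrec.eq.comp hm' (Primrec.const 0)) (Code.primrec₂_pair.comp ha hb)
      (Primrec.ite (Primrec.eq.comp hm' (Primrec.const 1)) (Code.primrec₂_comp.comp ha hb)
        (Code.primrec₂_prec.comp ha hb))

/-- Subprograms have smaller indices, so the translation is a course-of-values recursion on the
index. A compound program has index `4 * q + 5 + m` with `m < 4`, where `m` names the constructor
and `q` codes the arguments. -/
theorem primrec_toCode_ofIndex {r : Code → Code} (hr : Primrec r) :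
    Primrec fun n => toCode r (ofIndex n) := by
  have h : Primrec₂ fun (_ : Unit) n => toCode r (ofIndex n) := by
    refine Primrec.nat_strong_rec _ (g := fun _ => toCodeStep r)
      ((primrec_toCodeStep hr).comp Primrec.snd).to₂ ?_
    intro _ n
    obtain ⟨c, rfl⟩ := index_bijective.2 n
    have get : ∀ {d : OracleCode}, d.index < c.index →
        ((List.range c.index).map fun n => toCode r (ofIndex n))[d.index]? =
          some (toCode r d) := by
      intro d hd
      simp [hd]
    have left_le : ∀ a b : ℕ, a ≤ Nat.pair a b := Nat.left_le_pair
    have right_le : ∀ a b : ℕ, b ≤ Nat.pair a b := Nat.right_le_pair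
    have step : ∀ (q m : ℕ), m < 4 → (4 * q + 5 + m - 5) / 4 = q ∧ (4 * q + 5 + m - 5) % 4 = m := by
      intro q m hm
      omega
    rw [ofIndex_index]
    cases c with
    | zero | succ | left | right | oracle => simp [toCodeStep, index, toCode]
    | pair a b =>
      have h1 := left_le a.index b.index
      have h2 := right_le a.index b.index
      have ga := get (d := a) (by simp only [index]; omega)
      have gb := get (d := b) (by simp only [index]; omega)
      obtain ⟨e1, e2⟩ := step (Nat.pair a.index b.index) 0 (by norm_num)
      simp only [index] at ga gb
      simp only [toCodeStep, List.length_map, List.length_range, index, add_zero] at e1 e2 ⊢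
      rw [if_neg (by omega), e1, e2]
      simp [toCode, ga, gb]
    | comp a b =>
      have h1 := left_le a.index b.index
      have h2 := right_le a.index b.index
      have ga := get (d := a) (by simp only [index]; omega)
      have gb := get (d := b) (by simp only [index]; omega)
      obtain ⟨e1, e2⟩ := step (Nat.pair a.index b.index) 1 (by norm_num)
      simp only [index] at ga gb
      simp only [toCodeStep, List.length_map, List.length_range, index, add_assoc,
        Nat.reduceAdd] at e1 e2 ⊢
      rw [if_neg (by omega), e1, e2]
      simp [toCode, ga, gb]
    | prec a b =>
      have h1 := left_le a.index b.index
      have h2 := right_le a.index b.index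
      have ga := get (d := a) (by simp only [index]; omega)
      have gb := get (d := b) (by simp only [index]; omega)
      obtain ⟨e1, e2⟩ := step (Nat.pair a.index b.index) 2 (by norm_num)
      simp only [index] at ga gb
      simp only [toCodeStep, List.length_map, List.length_range, index, add_assoc,
        Nat.reduceAdd] at e1 e2 ⊢
      rw [if_neg (by omega), e1, e2]
      simp [toCode, ga, gb]
    | rfind a =>
      have ga := get (d := a) (by simp only [index]; omega)
      obtain ⟨e1, e2⟩ := step a.index 3 (by norm_num)
      simp only [index] at ga
      simp only [toCodeStep, List.length_map, List.length_range, index, add_assoc,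
        Nat.reduceAdd] at e1 e2 ⊢
      rw [if_neg (by omega), e1, e2]
      simp [toCode, ga]
  exact h.comp (Primrec.const ()) Primrec.id

/-- The translation of `rfind`. -/
def rfindCode (c : Code) : Code :=
  .comp (.rfind' c) (.pair .id .zero)

theorem primrec_rfindCode : Primrec rfindCode :=
  Code.primrec₂_comp.comp Code.primrec_rfind' (Primrec.const _)

/-- The characteristic function of `∅` is constantly `0`, which justifies replacing oracle calls by
`zero`. The search of `rfind'` starts at the second component of its input, which `rfindCode` sets
to `0`. -/
theorem eval_toCode (c : OracleCode) :
    (toCode rfindCode c).eval = c.eval (charFun ∅) := by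
  induction c with
  | zero | succ | left | right => rfl
  | oracle =>
    funext n
    simp [toCode, eval, Code.eval, charFun]
    rfl
  | pair c d ihc ihd =>
    simp only [toCode, eval, Code.eval, ihc, ihd]
    rfl
  | comp c d ihc ihd =>
    simp only [toCode, eval, Code.eval, ihc, ihd]
    rfl
  | prec c d ihc ihd =>
    simp only [toCode, eval, Code.eval, ihc, ihd]
    rfl
  | rfind c ihc =>
    funext n
    simp only [toCode, rfindCode, eval, Code.eval, ihc, Code.eval_id]
    simp [Seq.seq, Part.map_id', pure, PFun.pure]

end OracleCode

/-- The jump of the empty set has a `Σ₂` graph. -/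
theorem isSigmaTwo_charFun_jump_empty :
    IsSigmaTwo fun p : ℕ × ℕ => p.2 ∈ (charFun (jump ∅) : ℕ →. ℕ) p.1 := by
  classical
  let r : ℕ → ℕ → Prop := fun e k =>
    (Nat.Partrec.Code.evaln k (OracleCode.toCode OracleCode.rfindCode (OracleCode.ofIndex e))
      e).isSome = true
  have hr : PrimrecRel r := by
    refine Primrec.eq.comp (Primrec.option_isSome.comp ?_) (Primrec.const true)
    exact Nat.Partrec.Code.primrec_evaln.comp (Primrec.pair (Primrec.pair Primrec.snd
      ((OracleCode.primrec_toCode_ofIndex OracleCode.primrec_rfindCode).comp Primrec.fst))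
      Primrec.fst)
  have mem : ∀ e, e ∈ jump ∅ ↔ ∃ k, r e k := by
    intro e
    have : e ∈ jump ∅ ↔ ((OracleCode.ofIndex e).eval (charFun ∅) e).Dom := by
      constructor
      · rintro ⟨c, rfl, h⟩
        simpa using h
      · exact fun h => ⟨_, OracleCode.index_ofIndex e, h⟩
    rw [this, ← OracleCode.eval_toCode, Part.dom_iff_mem]
    simp only [Nat.Partrec.Code.evaln_complete, r, Option.isSome_iff_exists, Option.mem_def]
    exact exists_comm
  -- Value `1` is witnessed by a halting stage, held by the existential variable; value `0` says
  -- that no stage, taken from the universal variable, is a halting one.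
  refine ⟨fun q => (q.1.2 = 1 ∧ r q.1.1 q.2.1) ∨ (q.1.2 = 0 ∧ ¬ r q.1.1 q.2.2), ?_, ?_⟩
  · have h1 : Primrec fun q : (ℕ × ℕ) × ℕ × ℕ => q.1.1 := Primrec.fst.comp Primrec.fst
    have h2 : Primrec fun q : (ℕ × ℕ) × ℕ × ℕ => q.1.2 := Primrec.snd.comp Primrec.fst
    exact ((Primrec.eq.comp h2 (Primrec.const 1)).and
      (hr.comp h1 (Primrec.fst.comp Primrec.snd))).or
      ((Primrec.eq.comp h2 (Primrec.const 0)).and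
        (hr.comp h1 (Primrec.snd.comp Primrec.snd)).not)
  · rintro ⟨e, y⟩
    have hy : y ∈ (charFun (jump ∅) : ℕ →. ℕ) e ↔ y = charFun (jump ∅) e := by simp
    refine hy.trans ?_
    dsimp only
    by_cases he : e ∈ jump ∅
    · obtain ⟨k, hk⟩ := (mem e).1 he
      simp only [charFun, he, if_true]
      constructor
      · exact fun h => ⟨k, fun _ => Or.inl ⟨h, hk⟩⟩
      · rintro ⟨v, hv⟩
        rcases hv k with h | h
        · exact h.1
        · exact absurd hk h.2
    · have hn : ∀ k, ¬ r e k := fun k hk => he ((mem e).2 ⟨k, hk⟩)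
      simp only [charFun, he, if_false]
      constructor
      · exact fun h => ⟨0, fun w => Or.inr ⟨h, hn w⟩⟩
      · rintro ⟨v, hv⟩
        rcases hv 0 with h | h
        · exact absurd h.2 (hn v)
        · exact h.1

/-! ### A computable enumeration of the primitive recursive functions -/

namespace OracleCode

open Nat.Partrec (Code)

/-- Once each `rfind` is replaced by `zero`, only the primitive recursive constructors remain, and
these preserve totality. -/
theorem dom_eval_toCode_zero (c : OracleCode) (n : ℕ) :
    ((toCode (fun _ => Code.zero) c).eval n).Dom := by
  induction c generalizing n with
  | zero | succ | left | right | oracle | rfind => exact trivial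
  | pair c d ihc ihd =>
    simp only [toCode, Code.eval]
    simp [Seq.seq, ihc, ihd]
  | comp c d ihc ihd =>
    simp only [toCode, Code.eval]
    exact Part.dom_iff_mem.2 ⟨_, Part.mem_bind (Part.get_mem (ihd n)) (Part.get_mem (ihc _))⟩
  | prec c d ihc ihd =>
    simp only [toCode, Code.eval, Nat.unpaired]
    induction n.unpair.2 with
    | zero => exact ihc _
    | succ m ih =>
      exact Part.dom_iff_mem.2 ⟨_, Part.mem_bind (Part.get_mem ih) (Part.get_mem (ihd _))⟩

/-- A computable function that enumerates all primitive recursive functions. -/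
noncomputable def primrecUniv (c n : ℕ) : ℕ :=
  ((toCode (fun _ => Code.zero) (ofIndex c)).eval n).get (dom_eval_toCode_zero _ n)

theorem computable_primrecUniv : Computable₂ primrecUniv := by
  have h : Partrec fun p : ℕ × ℕ => (toCode (fun _ => Code.zero) (ofIndex p.1)).eval p.2 :=
    Code.eval_part.comp
      ((primrec_toCode_ofIndex (Primrec.const Code.zero)).to_comp.comp Computable.fst)
      Computable.snd
  exact h.of_eq_tot fun p => Part.get_mem _

theorem exists_primrecUniv_eq {f : ℕ → ℕ} (hf : Nat.Primrec f) : ∃ c, primrecUniv c = f := by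
  suffices h : ∃ c : OracleCode, ∀ n, f n ∈ (toCode (fun _ => Code.zero) c).eval n by
    obtain ⟨c, hc⟩ := h
    refine ⟨c.index, funext fun n => Part.get_eq_of_mem ?_ _⟩
    rw [ofIndex_index]
    exact hc n
  induction hf with
  | zero => exact ⟨zero, fun n => Part.mem_some _⟩
  | succ => exact ⟨succ, fun n => Part.mem_some _⟩
  | left => exact ⟨left, fun n => Part.mem_some _⟩
  | right => exact ⟨right, fun n => Part.mem_some _⟩
  | pair _ _ ihf ihg =>
    obtain ⟨c, hc⟩ := ihf
    obtain ⟨d, hd⟩ := ihg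
    refine ⟨pair c d, fun n => ?_⟩
    simp only [toCode, Code.eval]
    simp only [Seq.seq, Part.map_eq_map, Part.mem_bind_iff, Part.mem_map_iff]
    exact ⟨_, ⟨_, hc n, rfl⟩, _, hd n, rfl⟩
  | comp _ _ ihf ihg =>
    obtain ⟨c, hc⟩ := ihf
    obtain ⟨d, hd⟩ := ihg
    exact ⟨comp c d, fun n => Part.mem_bind (hd n) (hc _)⟩
  | prec _ _ ihf ihg =>
    obtain ⟨c, hc⟩ := ihf
    obtain ⟨d, hd⟩ := ihg
    refine ⟨prec c d, fun n => ?_⟩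
    simp only [toCode, Code.eval, Nat.unpaired]
    induction n.unpair.2 with
    | zero => exact hc _
    | succ m ih => exact Part.mem_bind ih (hd _)

end OracleCode

/-! ### Sets that are computably enumerable in a low set -/

theorem exists_oracleCode {g : ℕ → ℕ} {f : ℕ →. ℕ} (hf : Nat.RecursiveIn {(g : ℕ →. ℕ)} f) :
    ∃ c : OracleCode, c.eval g = f := by
  induction hf with
  | zero => exact ⟨.zero, rfl⟩
  | succ => exact ⟨.succ, rfl⟩
  | left => exact ⟨.left, rfl⟩
  | right => exact ⟨.right, rfl⟩
  | oracle g' hg' =>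
    obtain rfl : g' = _ := hg'
    exact ⟨.oracle, rfl⟩
  | pair _ _ ihf ihg =>
    obtain ⟨c, rfl⟩ := ihf
    obtain ⟨d, rfl⟩ := ihg
    exact ⟨.pair c d, rfl⟩
  | comp _ _ ihf ihg =>
    obtain ⟨c, rfl⟩ := ihf
    obtain ⟨d, rfl⟩ := ihg
    exact ⟨.comp c d, rfl⟩
  | prec _ _ ihf ihg =>
    obtain ⟨c, rfl⟩ := ihf
    obtain ⟨d, rfl⟩ := ihg
    exact ⟨.prec c d, rfl⟩
  | rfind _ ihf =>
    obtain ⟨c, rfl⟩ := ihf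
    exact ⟨.rfind c, rfl⟩

namespace OracleCode

/-- A program for a constant function. -/
def const : ℕ → OracleCode
  | 0 => zero
  | n + 1 => comp succ (const n)

theorem eval_const (g : ℕ → ℕ) (z n : ℕ) : (const z).eval g n = Part.some z := by
  induction z with
  | zero => rfl
  | succ z ih => simp [const, eval, ih]

theorem primrec_index_const : Primrec fun z => (const z).index := by
  refine (Primrec.nat_rec₁ 0 (f := fun _ i => 4 * Nat.pair 1 i + 6) ?_).of_eq fun z => ?_
  · exact Primrec.nat_add.comp (Primrec.nat_mul.comp (Primrec.const 4)
      (Primrec₂.natPair.comp (Primrec.const 1) Primrec.snd)) (Primrec.const 6)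
  · induction z with
    | zero => rfl
    | succ z ih =>
      simp only [const, index, ← ih]

end OracleCode

/-- The domain of a function recursive in `A` is many-one reducible to the jump of `A`. -/
theorem exists_primrec_mem_jump {A : Set ℕ} {f : ℕ →. ℕ}
    (hf : Nat.RecursiveIn {(charFun A : ℕ →. ℕ)} f) :
    ∃ h : ℕ → ℕ, Primrec h ∧ ∀ z, h z ∈ jump A ↔ (f z).Dom := by
  obtain ⟨c, rfl⟩ := exists_oracleCode hf
  -- The composite program ignores its input, so it halts on its own index exactly when `c` halts on
  -- `z`.
  refine ⟨fun z => (OracleCode.comp c (.const z)).index, ?_, fun z => ?_⟩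
  · exact Primrec.nat_add.comp (Primrec.nat_mul.comp (Primrec.const 4)
      (Primrec₂.natPair.comp (Primrec.const _) OracleCode.primrec_index_const)) (Primrec.const 6)
  · have h : ∀ n, (OracleCode.comp c (.const z)).eval (charFun A) n = c.eval (charFun A) z := by
      intro n
      exact (congrArg (Part.bind · (c.eval (charFun A))) (OracleCode.eval_const _ z n)).trans
        (Part.bind_some _ _)
    constructor
    · rintro ⟨d, hd, hdom⟩
      rw [OracleCode.index_bijective.1 hd, h] at hdom
      exact hdom
    · exact fun hdom => ⟨_, rfl, by rw [h]; exact hdom⟩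

theorem recursiveIn_of_computable {f : ℕ → ℕ} (hf : Computable f) {O : Set (ℕ →. ℕ)} :
    Nat.RecursiveIn O (f : ℕ →. ℕ) :=
  Nat.Partrec.recursiveIn (Partrec.nat_iff.1 hf.partrec)

theorem recursiveIn_comp {f g : ℕ → ℕ} {O : Set (ℕ →. ℕ)} (hf : Nat.RecursiveIn O (f : ℕ →. ℕ))
    (hg : Nat.RecursiveIn O (g : ℕ →. ℕ)) :
    Nat.RecursiveIn O ((fun n => f (g n) : ℕ → ℕ) : ℕ →. ℕ) :=
  (hf.comp hg).of_eq fun _ => Part.bind_some _ _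

theorem recursiveIn_pair {f g : ℕ → ℕ} {O : Set (ℕ →. ℕ)} (hf : Nat.RecursiveIn O (f : ℕ →. ℕ))
    (hg : Nat.RecursiveIn O (g : ℕ →. ℕ)) :
    Nat.RecursiveIn O ((fun n => Nat.pair (f n) (g n) : ℕ → ℕ) : ℕ →. ℕ) :=
  (hf.pair hg).of_eq fun n => by simp [Seq.seq]

/-- The answers are appended one at a time by `prec`; its parameter is not used, which is why the
length stands in the second component. -/
theorem recursiveIn_initSeg (X : Set ℕ) :
    Nat.RecursiveIn {(charFun X : ℕ →. ℕ)}
      ((fun p => encode (initSeg X p.unpair.2) : ℕ → ℕ) : ℕ →. ℕ) := by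
  classical
  let O : Set (ℕ →. ℕ) := {(charFun X : ℕ →. ℕ)}
  have h0 : Nat.RecursiveIn O ((fun _ => encode ([] : List Bool) : ℕ → ℕ) : ℕ →. ℕ) :=
    recursiveIn_of_computable (Computable.const _)
  let app : ℕ → ℕ := fun p =>
    encode (((decode (α := List Bool) p.unpair.1).getD []) ++ [decide (p.unpair.2 = 1)])
  have happ : Computable app := by
    refine (Primrec.encode.comp (Primrec.list_append.comp ?_ ?_)).to_comp
    · exact Primrec.option_getD.comp (Primrec.decode.comp (Primrec.fst.comp Primrec.unpair))
        (Primrec.const [])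
    · exact Primrec.list_cons.comp (Primrec.eq.decide.comp (Primrec.snd.comp Primrec.unpair)
        (Primrec.const 1)) (Primrec.const [])
  have hy : Computable fun p : ℕ => p.unpair.2.unpair.1 :=
    (Primrec.fst.comp (Primrec.unpair.comp (Primrec.snd.comp Primrec.unpair))).to_comp
  have hi : Computable fun p : ℕ => p.unpair.2.unpair.2 :=
    (Primrec.snd.comp (Primrec.unpair.comp (Primrec.snd.comp Primrec.unpair))).to_comp
  have h1 := recursiveIn_comp (O := O) (recursiveIn_of_computable happ)
    (recursiveIn_pair (recursiveIn_of_computable hi)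
      (recursiveIn_comp (Nat.RecursiveIn.oracle _ rfl) (recursiveIn_of_computable hy)))
  refine (h0.prec h1).of_eq fun p => ?_
  change _ = Part.some (encode (initSeg X p.unpair.2))
  dsimp only
  induction p.unpair.2 with
  | zero => rfl
  | succ n ih =>
    refine (congrArg (Part.bind · _) ih).trans ((Part.bind_some _ _).trans ?_)
    refine congrArg Part.some ?_
    by_cases hn : n ∈ X <;> simp [app, initSeg_succ, charFun, hn]

/-- If `X ≤ₜ A` and `A` is low then the predicates that are `Σ₂` relative to `X` are `Σ₂`. -/
theorem isSigmaTwo_of_low {A X : Set ℕ}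
    (hX : Nat.RecursiveIn {(charFun A : ℕ →. ℕ)} (charFun X : ℕ →. ℕ))
    (hA : Nat.RecursiveIn {(charFun (jump ∅) : ℕ →. ℕ)} (charFun (jump A) : ℕ →. ℕ))
    {B : ℕ × ℕ × ℕ → List Bool → Bool} (hB : Computable₂ B) :
    IsSigmaTwo fun k : ℕ => ∃ c, ∀ m b, B (k, c, m) (initSeg X b) = false := by
  -- The argument codes `⟨⟨⟨k, c⟩, ⟨m, b⟩⟩, σ⟩`. The value `0` signals acceptance by `B`, so a
  -- search for a zero over `⟨m, b⟩`, with `σ` the segment of length `b`, halts exactly when the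
  -- universal statement about `k` and `c` fails.
  let t : ℕ → ℕ := fun p =>
    bif B (p.unpair.1.unpair.1.unpair.1, p.unpair.1.unpair.1.unpair.2, p.unpair.1.unpair.2.unpair.1)
      ((decode (α := List Bool) p.unpair.2).getD []) then 0 else 1
  have ht : Computable t := by
    have u : ∀ {f : ℕ → ℕ}, Computable f →
        Computable (fun n => (f n).unpair.1) ∧ Computable (fun n => (f n).unpair.2) := fun hf =>
      ⟨Computable.fst.comp (Computable.unpair.comp hf),
        Computable.snd.comp (Computable.unpair.comp hf)⟩
    have u0 := u Computable.id
    have u1 := u u0.1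
    refine Computable.cond (hB.comp (((u u1.1).1).pair (((u u1.1).2).pair (u u1.2).1)) ?_)
      (Computable.const 0) (Computable.const 1)
    exact Computable.option_getD (Computable.decode.comp u0.2) (Computable.const [])
  have hseg := recursiveIn_comp (recursiveIn_initSeg X) (recursiveIn_of_computable
    (Computable.snd.comp Computable.unpair))
  have hid := recursiveIn_of_computable (O := {(charFun X : ℕ →. ℕ)}) Computable.id
  have hf := ((recursiveIn_comp (recursiveIn_of_computable ht)
    (recursiveIn_pair hid hseg)).rfind).subst (O' := {(charFun A : ℕ →. ℕ)})
      (fun g hg => by obtain rfl : g = _ := hg; exact hX)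
  obtain ⟨h, hh, hdom⟩ := exists_primrec_mem_jump hf
  have hz : ∀ k c, h (Nat.pair k c) ∈ jump A ↔ ∃ m b, B (k, c, m) (initSeg X b) = true := by
    intro k c
    rw [hdom]
    refine Nat.rfind_dom'.trans ?_
    simp [t, Bool.cond_eq_ite]
    constructor
    · rintro ⟨n, hn⟩
      exact ⟨_, _, hn⟩
    · rintro ⟨m, b, hmb⟩
      exact ⟨Nat.pair m b, by simpa using hmb⟩
  -- Lowness enters here: the jump of `A` is recursive in the jump of `∅`, so its characteristic
  -- function has a `Σ₂` graph. Non-membership is the value `0`.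
  have hS := isSigmaTwo_graph isSigmaTwo_charFun_jump_empty hA
  refine ((hS.comp (f := fun p : ℕ × ℕ => (h (Nat.pair p.1 p.2), 0))
    (Primrec.pair (hh.comp Primrec₂.natPair) (Primrec.const 0))).exists_nat).of_eq fun k => ?_
  refine exists_congr fun c => ?_
  have : (0 : ℕ) ∈ (charFun (jump A) : ℕ →. ℕ) (h (Nat.pair k c)) ↔
      h (Nat.pair k c) ∉ jump A := by
    by_cases hm : h (Nat.pair k c) ∈ jump A <;> simp [charFun, hm]
  refine this.trans ?_
  rw [hz]
  simp

/-! ### Simulation of oracle machines by primitive recursive functions -/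

/-- A finite type is primitively codable. -/
@[reducible] noncomputable def primcodableOfFinite (α : Type) [Finite α] : Primcodable α :=
  Primcodable.ofEquiv (Fin (Nat.card α)) (Finite.equivFin α)

/-- The type of families indexed by a finite type is primitively codable. -/
@[reducible] noncomputable def primcodablePi (K α : Type) [Finite K] [Primcodable α] :
    Primcodable (K → α) :=
  Primcodable.ofEquiv (Fin (Nat.card K) → α) (Equiv.arrowCongr (Finite.equivFin K) (Equiv.refl α))

section

attribute [local instance] primcodablePi

theorem primrec_pi_apply {K α : Type} [Finite K] [Primcodable α] (k : K) :
    Primrec fun S : K → α => S k := by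
  have h : Primrec (Equiv.arrowCongr (Finite.equivFin K) (Equiv.refl α)) := Primrec.of_equiv
  refine (Primrec.fin_app.comp h (Primrec.const (Finite.equivFin K k))).of_eq fun S => ?_
  simp [Equiv.arrowCongr]

theorem primrec_pi {K α β : Type} [Finite K] [Primcodable α] [Primcodable β] {f : β → K → α}
    (hf : ∀ k, Primrec fun b => f b k) : Primrec f := by
  have h : Primrec fun b => Equiv.arrowCongr (Finite.equivFin K) (Equiv.refl α) (f b) := by
    refine Primrec.fin_curry.2 (Primrec₂.swap (Primrec.fin_curry₁.2 fun i => ?_))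
    exact hf ((Finite.equivFin K).symm i)
  exact (Primrec.of_equiv_iff _).1 h

theorem primrec_update {K α β : Type} [Finite K] [DecidableEq K] [Primcodable α] [Primcodable β]
    {S : β → K → α} {a : β → α} (hS : Primrec S) (ha : Primrec a) (k : K) :
    Primrec fun b => Function.update (S b) k (a b) := by
  refine primrec_pi fun k' => ?_
  by_cases h : k' = k
  · subst h
    simpa using ha
  · simpa [h] using (primrec_pi_apply k').comp hS

/-- Over a finite type, a case distinction combines the separate proofs; no uniformity in `l` is
required. -/
theorem primrec_of_finite_left {Λ β γ : Type} [Finite Λ] [Primcodable Λ] [Primcodable β]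
    [Primcodable γ] {F : Λ → β → γ} (hF : ∀ l, Primrec (F l)) : Primrec₂ F := by
  have h : Primrec₂ fun (i : Fin (Nat.card Λ)) b => F ((Finite.equivFin Λ).symm i) b :=
    Primrec.fin_curry₁.2 fun i => hF _
  exact (h.comp ((Primrec.dom_finite (Finite.equivFin Λ)).comp Primrec.fst) Primrec.snd).of_eq
    fun p => by simp

variable {K Γ Λ σ : Type} [DecidableEq K] [Finite K] [Finite Γ] [Finite σ]
  [Primcodable Γ] [Primcodable Λ] [Primcodable σ]

/-- The components of a configuration. -/
def cfgTriple (c : Turing.TM2.Cfg (fun _ : K => Γ) Λ σ) : Option Λ × σ × (K → List Γ) :=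
  (c.l, c.var, c.stk)

theorem primrec_stepAux (q : Turing.TM2.Stmt (fun _ : K => Γ) Λ σ) {β : Type} [Primcodable β]
    {v : β → σ} {S : β → K → List Γ} (hv : Primrec v) (hS : Primrec S) :
    Primrec fun b => cfgTriple (Turing.TM2.stepAux q (v b) (S b)) := by
  have top : ∀ {v : β → σ} {S : β → K → List Γ} (_ : Primrec v) (_ : Primrec S) (k : K)
      (f : σ → Option Γ → σ), Primrec fun b => f (v b) (S b k).head? := fun hv hS k f =>
    (Primrec.dom_finite fun p : σ × Option Γ => f p.1 p.2).comp
      (hv.pair (Primrec.list_head?.comp ((primrec_pi_apply k).comp hS)))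
  induction q generalizing v S with
  | push k f q ih =>
    exact ih hv (primrec_update hS (Primrec.list_cons.comp ((Primrec.dom_finite f).comp hv)
      ((primrec_pi_apply k).comp hS)) k)
  | peek k f q ih => exact ih (top hv hS k f) hS
  | pop k f q ih =>
    exact ih (top hv hS k f)
      (primrec_update hS (Primrec.list_tail.comp ((primrec_pi_apply k).comp hS)) k)
  | load f q ih => exact ih ((Primrec.dom_finite f).comp hv) hS
  | branch f q₁ q₂ ih₁ ih₂ =>
    refine (Primrec.cond ((Primrec.dom_finite f).comp hv) (ih₁ hv hS) (ih₂ hv hS)).of_eq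
      fun b => ?_
    simp only [Turing.TM2.stepAux]
    cases f (v b) <;> rfl
  | goto f =>
    exact (Primrec.option_some.comp ((Primrec.dom_finite f).comp hv)).pair (hv.pair hS)
  | halt => exact (Primrec.const none).pair (hv.pair hS)

end

/-! ### Computations of a machine with a finite part of its oracle. -/

namespace OracleTM

attribute [instance] finK finΓ finΛ finσ

variable (M : OracleTM)

open Classical in
/-- The bit denoted by a symbol. -/
noncomputable def unbit (g : M.Γ) : Option Bool :=
  if g = M.bit true then some true else if g = M.bit false then some false else none

theorem unbit_eq_some {g : M.Γ} {b : Bool} : M.unbit g = some b ↔ g = M.bit b := by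
  have h : M.bit false ≠ M.bit true := fun h => by simpa using M.bit.injective h
  unfold unbit
  constructor
  · split_ifs with h1 h2 <;> simp <;> rintro rfl <;> assumption
  · rintro rfl
    cases b <;> simp [h]

/-- The number of the query string on the query stack, if the stack holds a binary string. -/
noncomputable def queryNum (q : List M.Γ) : Option ℕ :=
  q.foldr (fun g o => o.bind fun n => (M.unbit g).map fun b => 2 * n + 1 + b.toNat) (some 0)

/-- The top of the query stack is the last bit pushed, hence the last bit of the string, so the fold
follows the recursion `strNum_concat`. -/
theorem queryNum_eq_some {q : List M.Γ} {n : ℕ} :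
    M.queryNum q = some n ↔ ∃ y : List Bool, q.reverse = y.map M.bit ∧ strNum y = n := by
  induction q generalizing n with
  | nil =>
    constructor
    · intro h
      exact ⟨[], rfl, by simpa [queryNum, strNum] using h⟩
    · rintro ⟨y, hy, rfl⟩
      obtain rfl : y = [] := by simpa using hy.symm
      rfl
  | cons g q ih =>
    have e : M.queryNum (g :: q) =
        (M.queryNum q).bind fun n => (M.unbit g).map fun b => 2 * n + 1 + b.toNat := rfl
    simp only [e, Option.bind_eq_some_iff, Option.map_eq_some_iff, unbit_eq_some, ih]
    constructor
    · rintro ⟨m, ⟨y, hy, rfl⟩, b, rfl, rfl⟩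
      exact ⟨y ++ [b], by simp [hy], strNum_concat y b⟩
    · rintro ⟨y, hy, rfl⟩
      rcases List.eq_nil_or_concat' y with rfl | ⟨y, b, rfl⟩
      · simp at hy
      · simp only [List.reverse_cons, List.map_append, List.map_cons, List.map_nil] at hy
        have h := List.append_inj' hy rfl
        exact ⟨_, ⟨y, h.1, rfl⟩, b, by simpa using h.2, (strNum_concat y b).symm⟩

/-- The answer to a query by an initial segment of an oracle; `none` if the segment is too
short. -/
noncomputable def segAnswer (τ : List Bool) (q : List M.Γ) : Option Bool :=
  (M.queryNum q).elim (some false) fun n => τ[n]?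

theorem segAnswer_sound {X : Set ℕ} {b : ℕ} {q : List M.Γ} {a : Bool}
    (h : M.segAnswer (initSeg X b) q = some a) : M.answer X q = a := by
  classical
  unfold segAnswer at h
  cases hq : M.queryNum q with
  | none =>
    have hno : ¬ ∃ y : List Bool, q.reverse = y.map M.bit ∧ strNum y ∈ X := by
      rintro ⟨y, hy, -⟩
      have := M.queryNum_eq_some.2 ⟨y, hy, rfl⟩
      simp [hq] at this
    simp only [hq, Option.elim_none, Option.some.injEq] at h
    simp [answer, hno, ← h]
  | some n =>
    obtain ⟨y, hy, rfl⟩ := M.queryNum_eq_some.1 hq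
    have hiff : (∃ y : List Bool, q.reverse = y.map M.bit ∧ strNum y ∈ X) ↔ strNum y ∈ X := by
      constructor
      · rintro ⟨z, hz, hzX⟩
        rwa [(List.map_injective_iff.2 M.bit.injective) (hy.symm.trans hz)]
      · exact fun h => ⟨y, hy, h⟩
    simp only [hq, Option.elim_some, getElem?_initSeg] at h
    split_ifs at h
    rw [← Option.some.inj h]
    unfold answer
    exact decide_eq_decide.2 hiff

theorem segAnswer_complete (X : Set ℕ) (q : List M.Γ) :
    ∃ b₀, ∀ b ≥ b₀, M.segAnswer (initSeg X b) q = some (M.answer X q) := by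
  classical
  suffices h : ∃ b₀, ∀ b ≥ b₀, ∃ a, M.segAnswer (initSeg X b) q = some a by
    obtain ⟨b₀, h⟩ := h
    refine ⟨b₀, fun b hb => ?_⟩
    obtain ⟨a, ha⟩ := h b hb
    rw [ha, M.segAnswer_sound ha]
  cases hq : M.queryNum q with
  | none => exact ⟨0, fun b _ => ⟨false, by simp [segAnswer, hq]⟩⟩
  | some n =>
    refine ⟨n + 1, fun b hb => ⟨decide (n ∈ X), ?_⟩⟩
    simp only [segAnswer, hq, Option.elim_some, getElem?_initSeg]
    rw [if_pos (by omega)]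

/-- One step of the computation with an initial segment as oracle. -/
noncomputable def segStep (τ : List Bool) (c : M.Cfg) : Option M.Cfg :=
  c.l.elim (some c) fun l =>
    match M.prog l with
    | Sum.inl s => some (Turing.TM2.stepAux s c.var c.stk)
    | Sum.inr next => (M.segAnswer τ (c.stk M.queryTape)).map fun b => ⟨some (next b), c.var, c.stk⟩

/-- The computation with an initial segment as oracle. -/
noncomputable def segRun (τ : List Bool) (x : List Bool) (t : ℕ) : Option M.Cfg :=
  t.rec (some (M.initCfg x)) fun _ c => c.bind (M.segStep τ)

theorem run_succ (X : Set ℕ) (x : List Bool) (t : ℕ) :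
    M.run X x (t + 1) = M.step X (M.run X x t) :=
  Function.iterate_succ_apply' _ _ _

theorem segStep_sound {X : Set ℕ} {b : ℕ} {c c' : M.Cfg}
    (h : M.segStep (initSeg X b) c = some c') : M.step X c = c' := by
  obtain ⟨l, v, S⟩ := c
  cases l with
  | none => simpa [segStep, step] using h
  | some l =>
    simp only [segStep, Option.elim_some] at h
    simp only [step]
    revert h
    cases M.prog l with
    | inl s => exact fun h => by simpa using h
    | inr next =>
      intro h
      obtain ⟨a, ha, rfl⟩ := Option.map_eq_some_iff.1 h
      simp only [M.segAnswer_sound ha]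

theorem segRun_sound {X : Set ℕ} {b : ℕ} {x : List Bool} {t : ℕ} {c : M.Cfg}
    (h : M.segRun (initSeg X b) x t = some c) : M.run X x t = c := by
  induction t generalizing c with
  | zero => simpa [segRun, run] using h
  | succ t ih =>
    obtain ⟨c', hc', h⟩ := Option.bind_eq_some_iff.1 h
    rw [run_succ, ih hc', M.segStep_sound h]

theorem segStep_complete (X : Set ℕ) (c : M.Cfg) :
    ∃ b₀, ∀ b ≥ b₀, M.segStep (initSeg X b) c = some (M.step X c) := by
  suffices h : ∃ b₀, ∀ b ≥ b₀, ∃ c', M.segStep (initSeg X b) c = some c' by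
    obtain ⟨b₀, h⟩ := h
    refine ⟨b₀, fun b hb => ?_⟩
    obtain ⟨a, ha⟩ := h b hb
    rw [ha, M.segStep_sound ha]
  obtain ⟨l, v, S⟩ := c
  cases l with
  | none => exact ⟨0, fun b _ => ⟨_, rfl⟩⟩
  | some l =>
    simp only [segStep, Option.elim_some]
    cases M.prog l with
    | inl s => exact ⟨0, fun b _ => ⟨_, rfl⟩⟩
    | inr next =>
      obtain ⟨b₀, h⟩ := M.segAnswer_complete X (S M.queryTape)
      exact ⟨b₀, fun b hb => ⟨_, by simp only [h b hb]; rfl⟩⟩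

/-- In `t` steps only finitely many queries are made, so every sufficiently long segment answers all
of them. -/
theorem segRun_complete (X : Set ℕ) (x : List Bool) (t : ℕ) :
    ∃ b₀, ∀ b ≥ b₀, M.segRun (initSeg X b) x t = some (M.run X x t) := by
  induction t with
  | zero => exact ⟨0, fun b _ => rfl⟩
  | succ t ih =>
    obtain ⟨b₀, h⟩ := ih
    obtain ⟨b₁, h'⟩ := M.segStep_complete X (M.run X x t)
    refine ⟨max b₀ b₁, fun b hb => ?_⟩
    rw [run_succ, ← h' b (le_of_max_le_right hb)]
    exact congrArg (Option.bind · (M.segStep (initSeg X b))) (h b (le_of_max_le_left hb))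

theorem segRun_of_oracleFree (hM : M.OracleFree) (X : Set ℕ) (τ x : List Bool) (t : ℕ) :
    M.segRun τ x t = some (M.run X x t) := by
  have hstep : ∀ c, M.segStep τ c = some (M.step X c) := by
    rintro ⟨l, v, S⟩
    cases l with
    | none => rfl
    | some l =>
      have := hM l
      simp only [segStep, Option.elim_some, step]
      cases hl : M.prog l with
      | inl s => rfl
      | inr next => simp [hl] at this
  induction t with
  | zero => rfl
  | succ t ih =>
    rw [run_succ, ← hstep]
    exact (congrArg (Option.bind · (M.segStep τ)) ih).trans rfl

/-- The output of the computation with an initial segment as oracle, if it has halted. -/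
noncomputable def segOut (τ : List Bool) (x : List Bool) (t : ℕ) : Option Bool :=
  (M.segRun τ x t).bind fun c => c.l.elim (some (M.out c.var)) fun _ => none

theorem segOut_eq_some {τ x : List Bool} {t : ℕ} {a : Bool} :
    M.segOut τ x t = some a ↔
      ∃ c, M.segRun τ x t = some c ∧ c.l = none ∧ M.out c.var = a := by
  unfold segOut
  rw [Option.bind_eq_some_iff]
  refine exists_congr fun c => and_congr_right fun _ => ?_
  cases c.l <;> simp

theorem segOut_sound {X : Set ℕ} {b : ℕ} {x : List Bool} {t : ℕ} {a : Bool}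
    (h : M.segOut (initSeg X b) x t = some a) :
    (M.run X x t).l = none ∧ M.out (M.run X x t).var = a := by
  obtain ⟨c, hc, h1, h2⟩ := M.segOut_eq_some.1 h
  rw [M.segRun_sound hc]
  exact ⟨h1, h2⟩

theorem segOut_complete {X : Set ℕ} {x : List Bool} {t : ℕ} (h : (M.run X x t).l = none) :
    ∃ b, M.segOut (initSeg X b) x t = some (M.out (M.run X x t).var) := by
  obtain ⟨b, hb⟩ := M.segRun_complete X x t
  exact ⟨b, M.segOut_eq_some.2 ⟨_, hb b le_rfl, h, rfl⟩⟩

theorem segOut_of_oracleFree (hM : M.OracleFree) {X : Set ℕ} {τ x : List Bool} {t : ℕ}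
    (h : (M.run X x t).l = none) : M.segOut τ x t = some (M.out (M.run X x t).var) :=
  M.segOut_eq_some.2 ⟨_, M.segRun_of_oracleFree hM X τ x t, h, rfl⟩

/-- For a fixed machine, labels, symbols and states form finite types, so every function on them is
primitive recursive; the stacks are lists. A run of `t` steps is an iteration of one primitive
recursive step. -/
theorem primrec_segOut :
    Primrec fun p : List Bool × List Bool × ℕ => M.segOut p.1 p.2.1 p.2.2 := by
  let _ := primcodableOfFinite M.Γ
  let _ := primcodableOfFinite M.Λ
  let _ := primcodableOfFinite M.σ
  let _ := primcodablePi M.K (List M.Γ)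
  let T := Option M.Λ × M.σ × (M.K → List M.Γ)
  let mk : T → M.Cfg := fun s => ⟨s.1, s.2.1, s.2.2⟩
  have hmk : ∀ c, mk (cfgTriple c) = c := fun _ => rfl
  have hquery : Primrec M.queryNum := by
    refine Primrec.list_foldr (f := fun q : List M.Γ => q) Primrec.id (Primrec.const (some 0))
      (h := fun _ (p : M.Γ × Option ℕ) =>
        p.2.bind fun n => (M.unbit p.1).map fun b => 2 * n + 1 + b.toNat) ?_
    refine Primrec.option_bind (Primrec.snd.comp Primrec.snd) ?_
    refine Primrec.option_map ((Primrec.dom_finite M.unbit).comp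
      (Primrec.fst.comp (Primrec.snd.comp Primrec.fst))) ?_
    exact Primrec.nat_add.comp (Primrec.succ.comp (Primrec.nat_mul.comp (Primrec.const 2)
      (Primrec.snd.comp Primrec.fst))) ((Primrec.dom_bool Bool.toNat).comp Primrec.snd)
  have hanswer : Primrec₂ M.segAnswer := by
    refine (Primrec.option_casesOn (hquery.comp Primrec.snd) (Primrec.const (some false))
      (Primrec.list_getElem?.comp (Primrec.fst.comp Primrec.fst) Primrec.snd).to₂).of_eq fun p => ?_
    unfold segAnswer
    cases M.queryNum p.2 <;> rfl
  have hstep : Primrec₂ fun (τ : List Bool) (s : T) => (M.segStep τ (mk s)).map cfgTriple := by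
    have hlab : Primrec₂ fun (l : M.Λ) (p : List Bool × T) =>
        (match M.prog l with
        | Sum.inl s => some (Turing.TM2.stepAux s p.2.2.1 p.2.2.2)
        | Sum.inr next => (M.segAnswer p.1 (p.2.2.2 M.queryTape)).map fun b =>
          (⟨some (next b), p.2.2.1, p.2.2.2⟩ : M.Cfg)).map cfgTriple := by
      have hv : Primrec fun p : List Bool × T => p.2.2.1 :=
        Primrec.fst.comp (Primrec.snd.comp Primrec.snd)
      have hS : Primrec fun p : List Bool × T => p.2.2.2 :=
        Primrec.snd.comp (Primrec.snd.comp Primrec.snd)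
      refine primrec_of_finite_left fun l => ?_
      cases M.prog l with
      | inl s => exact Primrec.option_some.comp (primrec_stepAux s hv hS)
      | inr next =>
        refine (Primrec.option_map (hanswer.comp Primrec.fst
          ((primrec_pi_apply M.queryTape).comp hS))
          (g := fun (p : List Bool × T) (b : Bool) =>
            ((some (next b), p.2.2.1, p.2.2.2) : T)) ?_).of_eq fun p => ?_
        · exact (Primrec.option_some.comp ((Primrec.dom_bool next).comp Primrec.snd)).pair
            ((hv.comp Primrec.fst).pair (hS.comp Primrec.fst))
        · simp only [Option.map_map]
          rfl
    refine (Primrec.option_casesOn (Primrec.fst.comp Primrec.snd)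
      (Primrec.option_some.comp Primrec.snd) (hlab.comp Primrec.snd Primrec.fst).to₂).of_eq
      fun p => ?_
    obtain ⟨τ, l, s⟩ := p
    cases l <;> rfl
  have hinit : Primrec fun x : List Bool => cfgTriple (M.initCfg x) := by
    refine (Primrec.const (some M.start)).pair ((Primrec.const M.init).pair ?_)
    exact primrec_update (Primrec.const _)
      (Primrec.list_map Primrec.id ((Primrec.dom_bool M.bit).comp Primrec.snd).to₂) M.inputTape
  have hrun : Primrec fun p : List Bool × List Bool × ℕ =>
      (M.segRun p.1 p.2.1 p.2.2).map cfgTriple := by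
    refine (Primrec.nat_rec' (Primrec.snd.comp Primrec.snd)
      (Primrec.option_some.comp (hinit.comp (Primrec.fst.comp Primrec.snd)))
      (h := fun (p : List Bool × List Bool × ℕ) (q : ℕ × Option T) =>
        q.2.bind fun s => (M.segStep p.1 (mk s)).map cfgTriple) ?_).of_eq fun p => ?_
    · exact Primrec.option_bind (Primrec.snd.comp Primrec.snd)
        (hstep.comp (Primrec.fst.comp (Primrec.fst.comp Primrec.fst)) Primrec.snd).to₂
    · obtain ⟨τ, x, t⟩ := p
      dsimp only
      induction t with
      | zero => rfl
      | succ t ih =>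
        have e : M.segRun τ x (t + 1) = (M.segRun τ x t).bind (M.segStep τ) := rfl
        rw [e]
        simp only [ih]
        cases M.segRun τ x t <;> rfl
  refine (Primrec.option_bind hrun (g := fun _ (s : T) =>
    Option.casesOn s.1 (some (M.out s.2.1)) fun _ => none) ?_).of_eq fun p => ?_
  · exact Primrec.option_casesOn (Primrec.fst.comp Primrec.snd) (Primrec.option_some.comp
      ((Primrec.dom_finite M.out).comp (Primrec.fst.comp (Primrec.snd.comp Primrec.snd))))
      (Primrec.const none).to₂
  · unfold segOut
    cases h : M.segRun p.1 p.2.1 p.2.2 with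
    | none => rfl
    | some c => cases hl : c.l <;> simp [cfgTriple, hl]

theorem run_of_halted {X : Set ℕ} {x : List Bool} {s t : ℕ} (hst : s ≤ t)
    (h : (M.run X x s).l = none) : M.run X x t = M.run X x s := by
  induction t, hst using Nat.le_induction with
  | base => rfl
  | succ t _ ih =>
    rw [run_succ, ih]
    cases hc : M.run X x s with
    | mk l v S =>
      rw [hc] at h
      obtain rfl : l = none := h
      rfl

end OracleTM

/-! ### Construction of oracle machines -/

open Turing in
/-- Transport of a statement along maps of stacks and labels, with halting replaced by a jump
to `e`, if `e` is a label. -/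
def mapStmt {K K₂ Γ Λ Λ₂ σ : Type} (ι : K → K₂) (r : Λ → Λ₂) (e : Option Λ₂) :
    TM2.Stmt (fun _ : K => Γ) Λ σ → TM2.Stmt (fun _ : K₂ => Γ) Λ₂ σ
  | .push k f q => .push (ι k) f (mapStmt ι r e q)
  | .peek k f q => .peek (ι k) f (mapStmt ι r e q)
  | .pop k f q => .pop (ι k) f (mapStmt ι r e q)
  | .load f q => .load f (mapStmt ι r e q)
  | .branch f q₁ q₂ => .branch f (mapStmt ι r e q₁) (mapStmt ι r e q₂)
  | .goto f => .goto fun s => r (f s)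
  | .halt => e.elim .halt fun l => .goto fun _ => l

open Turing in
theorem stepAux_mapStmt {K K₂ Γ Λ Λ₂ σ : Type} [DecidableEq K] [DecidableEq K₂] (r : Λ → Λ₂)
    (e : Option Λ₂) (T : K₂ → List Γ) (q : TM2.Stmt (fun _ : K => Γ) Λ σ) (v : σ) (S : K → List Γ) :
    TM2.stepAux (mapStmt Sum.inl r e q) v (Sum.elim S T : K ⊕ K₂ → List Γ) =
      ⟨(TM2.stepAux q v S).l.elim e fun l => some (r l), (TM2.stepAux q v S).var,
        Sum.elim (TM2.stepAux q v S).stk T⟩ := by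
  induction q generalizing v S with
  | push k f q ih =>
    have h : Function.update (Sum.elim S T) (Sum.inl k) (f v :: S k) =
      Sum.elim (Function.update S k (f v :: S k)) T := Sum.update_elim_inl
    simp only [mapStmt, TM2.stepAux, Sum.elim_inl, h, ih]
  | peek k f q ih => simp only [mapStmt, TM2.stepAux, Sum.elim_inl, ih]
  | pop k f q ih =>
    have h : Function.update (Sum.elim S T) (Sum.inl k) (S k).tail =
      Sum.elim (Function.update S k (S k).tail) T := Sum.update_elim_inl
    simp only [mapStmt, TM2.stepAux, Sum.elim_inl, h, ih]
  | load f q ih => simp only [mapStmt, TM2.stepAux, ih]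
  | branch f q₁ q₂ ih₁ ih₂ =>
    simp only [mapStmt, TM2.stepAux]
    cases f v
    · exact ih₂ v S
    · exact ih₁ v S
  | goto f => rfl
  | halt => cases e <;> rfl

open Turing in
theorem stepAux_mapStmt_id {K Γ Λ Λ₂ σ : Type} [DecidableEq K] (r : Λ → Λ₂)
    (q : TM2.Stmt (fun _ : K => Γ) Λ σ) (v : σ) (S : K → List Γ) :
    TM2.stepAux (mapStmt id r none q) v S =
      ⟨(TM2.stepAux q v S).l.map r, (TM2.stepAux q v S).var, (TM2.stepAux q v S).stk⟩ := by
  induction q generalizing v S with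
  | push k f q ih => simp only [mapStmt, TM2.stepAux, id, ih]
  | peek k f q ih => simp only [mapStmt, TM2.stepAux, id, ih]
  | pop k f q ih => simp only [mapStmt, TM2.stepAux, id, ih]
  | load f q ih => simp only [mapStmt, TM2.stepAux, ih]
  | branch f q₁ q₂ ih₁ ih₂ =>
    simp only [mapStmt, TM2.stepAux]
    cases f v
    · exact ih₂ v S
    · exact ih₁ v S
  | goto f => rfl
  | halt => rfl

namespace OracleTM

open Classical in
theorem answer_map_reverse (M : OracleTM) (X : Set ℕ) (y : List Bool) :
    M.answer X (y.map M.bit).reverse = decide (strNum y ∈ X) := by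
  refine decide_eq_decide.2 ⟨?_, fun h => ⟨y, by simp, h⟩⟩
  rintro ⟨z, hz, hzX⟩
  rw [List.reverse_reverse] at hz
  rwa [(List.map_injective_iff.2 M.bit.injective) hz]

/-- `M` with oracle `X` gets from `c` to `c'`. -/
def Reaches (M : OracleTM) (X : Set ℕ) (c c' : M.Cfg) : Prop :=
  ∃ t, (M.step X)^[t] c = c'

namespace Reaches

variable {M : OracleTM} {X : Set ℕ} {c c' c'' : M.Cfg}

theorem refl (c : M.Cfg) : M.Reaches X c c := ⟨0, rfl⟩

theorem trans (h : M.Reaches X c c') (h' : M.Reaches X c' c'') : M.Reaches X c c'' := by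
  obtain ⟨s, rfl⟩ := h
  obtain ⟨t, rfl⟩ := h'
  exact ⟨t + s, Function.iterate_add_apply _ _ _ _⟩

theorem single (h : M.step X c = c') : M.Reaches X c c' := ⟨1, h⟩

theorem head (h : M.step X c = c') (h' : M.Reaches X c' c'') : M.Reaches X c c'' :=
  (single h).trans h'

end Reaches

end OracleTM

/-! ### An oracle machine that alternates between a computation without oracle and queries. -/

namespace Driver

open Turing Turing.PartrecToTM2 OracleTM

/-- The labels of the driver program around a machine for a `ToPartrec.Code`. -/
inductive Ctl : Type
  | init | read | post | query | ask | clear (b : Bool)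

instance : Finite Ctl :=
  Finite.of_surjective (fun o : Fin 5 ⊕ Bool => o.elim ![.init, .read, .post, .query, .ask] .clear)
    fun l => by
      cases l with
      | init => exact ⟨.inl 0, rfl⟩
      | read => exact ⟨.inl 1, rfl⟩
      | post => exact ⟨.inl 2, rfl⟩
      | query => exact ⟨.inl 3, rfl⟩
      | ask => exact ⟨.inl 4, rfl⟩
      | clear b => exact ⟨.inr b, rfl⟩

instance : Finite Γ' :=
  Finite.of_surjective (![.consₗ, .cons, .bit0, .bit1] : Fin 4 → Γ') fun g => by
    cases g with
    | consₗ => exact ⟨0, rfl⟩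
    | cons => exact ⟨1, rfl⟩
    | bit0 => exact ⟨2, rfl⟩
    | bit1 => exact ⟨3, rfl⟩

instance : Finite K' :=
  Finite.of_surjective (![.main, .rev, .aux, .stack] : Fin 4 → K') fun k => by
    cases k with
    | main => exact ⟨0, rfl⟩
    | rev => exact ⟨1, rfl⟩
    | aux => exact ⟨2, rfl⟩
    | stack => exact ⟨3, rfl⟩

/-- The symbols for the bits. -/
def bitSymbol (b : Bool) : Γ' := cond b .bit1 .bit0

theorem trNat_two_mul_add {n : ℕ} (hn : 0 < n) (b : Bool) :
    trNat (2 * n + b.toNat) = bitSymbol b :: trNat n := by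
  obtain ⟨p, hp⟩ : ∃ p, (n : Num) = Num.pos p := by
    cases h : (n : Num) with
    | zero =>
      have : ((n : Num) : ℕ) = 0 := by rw [h]; rfl
      rw [Num.to_of_nat] at this
      omega
    | pos p => exact ⟨p, rfl⟩
  cases b
  · have : ((2 * n + false.toNat : ℕ) : Num) = Num.pos p.bit0 := by
      have h2 : 2 * n + false.toNat = n + n := by simp; ring
      rw [h2, Nat.cast_add, Num.bit0_of_bit0, hp]
      rfl
    rw [trNat, trNat, this, hp]
    rfl
  · have : ((2 * n + true.toNat : ℕ) : Num) = Num.pos p.bit1 := by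
      have h2 : 2 * n + true.toNat = n + n + 1 := by simp; ring
      rw [h2, Nat.cast_add, Nat.cast_add, Nat.cast_one, Num.bit1_of_bit1, hp]
      rfl
    rw [trNat, trNat, this, hp]
    rfl

theorem trNat_one : trNat 1 = [Γ'.bit1] := rfl

/-- The binary expansion of `strNum x + 1` is a leading `1` followed by `x`. `trNat` writes the
least significant bit first, so `x` appears reversed and the leading `1` comes last. -/
theorem trNat_strNum_succ (x : List Bool) :
    trNat (strNum x + 1) = (x.map bitSymbol).reverse ++ [Γ'.bit1] := by
  induction x using List.reverseRecOn with
  | nil => rfl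
  | append_singleton x b ih =>
    have h : strNum (x ++ [b]) + 1 = 2 * (strNum x + 1) + b.toNat := by
      rw [strNum_concat]
      ring
    rw [h, trNat_two_mul_add (Nat.succ_pos _), ih]
    simp

variable (c : ToPartrec.Code)

/-- The labels of the machine for `c`. -/
abbrev Lab : Type := {l // l ∈ codeSupp c Cont'.halt} ⊕ Ctl

open Classical in
/-- The embedding of the labels of the machine for `c`. -/
noncomputable def lab (l : Λ') : Lab c :=
  if h : l ∈ codeSupp c Cont'.halt then Sum.inl ⟨l, h⟩ else Sum.inr .post

/-- The label at which the computation of `c` starts. -/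
noncomputable def startLab : Lab c := lab c (trNormal c Cont'.halt)

/-- The driver program: transform the input string into a number, run `c` on lists of the form
`[answer, state]`; if the output is `[0, query, state]` then ask the oracle and run `c` again,
otherwise halt. -/
noncomputable def prog :
    Lab c → TM2.Stmt (fun _ : K' ⊕ Bool => Γ') (Lab c) (Option Γ') ⊕ (Bool → Lab c)
  | .inl l => .inl (mapStmt Sum.inl (lab c) (some (.inr .post)) (tr l.1))
  | .inr .init => .inl <| .push (.inl .main) (fun _ => .cons) <|
      .push (.inl .main) (fun _ => .cons) <|
      .push (.inl .main) (fun _ => .bit1) <| .goto fun _ => .inr .read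
  | .inr .read => .inl <| .pop (.inr false) (fun _ v => v) <| .branch Option.isSome
      (.push (.inl .main) (fun v => v.getD .cons) <| .goto fun _ => .inr .read)
      (.goto fun _ => startLab c)
  | .inr .post => .inl <| .pop (.inl .main) (fun _ v => v) <| .branch (fun v => v = some .cons)
      (.goto fun _ => .inr .query) .halt
  | .inr .query => .inl <| .pop (.inl .main) (fun _ v => v) <| .branch (fun v => v = some .cons)
      (.pop (.inr true) (fun _ v => v) <| .goto fun _ => .inr .ask)
      (.push (.inr true) (fun v => v.getD .cons) <| .goto fun _ => .inr .query)
  | .inr .ask => .inr fun b => .inr (.clear b)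
  | .inr (.clear b) => .inl <| .pop (.inr true) (fun _ v => v) <| .branch Option.isSome
      (.goto fun _ => .inr (.clear b))
      (.push (.inl .main) (fun _ => .cons) <|
        .branch (fun _ => b) (.push (.inl .main) (fun _ => .bit1) <| .goto fun _ => startLab c)
          (.goto fun _ => startLab c))

/-- The driver machine for `c`. -/
noncomputable def machine : OracleTM where
  K := K' ⊕ Bool
  Γ := Γ'
  Λ := Lab c
  σ := Option Γ'
  inputTape := .inr false
  queryTape := .inr true
  input_ne_query := by simp
  bit := ⟨bitSymbol, by intro a b; cases a <;> cases b <;> simp [bitSymbol]⟩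
  start := .inr .init
  init := none
  prog := prog c
  out v := v = some .bit0

/-- The stacks of the driver machine. -/
def stackFn (m i q : List Γ') : K' ⊕ Bool → List Γ' :=
  Sum.elim (K'.elim m [] [] []) fun b => cond b q i

@[simp] theorem stackFn_main (m i q) : stackFn m i q (.inl .main) = m := rfl
@[simp] theorem stackFn_input (m i q) : stackFn m i q (.inr false) = i := rfl
@[simp] theorem stackFn_query (m i q) : stackFn m i q (.inr true) = q := rfl

@[simp] theorem update_stackFn_main (m i q m') :
    Function.update (stackFn m i q) (.inl .main) m' = stackFn m' i q := by
  funext k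
  rcases k with k | b
  · cases k <;> rfl
  · cases b <;> rfl

@[simp] theorem update_stackFn_input (m i q i') :
    Function.update (stackFn m i q) (.inr false) i' = stackFn m i' q := by
  funext k
  rcases k with k | b
  · cases k <;> rfl
  · cases b <;> rfl

@[simp] theorem update_stackFn_query (m i q q') :
    Function.update (stackFn m i q) (.inr true) q' = stackFn m i q' := by
  funext k
  rcases k with k | b
  · cases k <;> rfl
  · cases b <;> rfl

/-- A running configuration of the driver machine. -/
def conf (l : Lab c) (v : Option Γ') (m i q : List Γ') :
    TM2.Cfg (fun _ : K' ⊕ Bool => Γ') (Lab c) (Option Γ') :=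
  ⟨some l, v, stackFn m i q⟩

variable {c} (X : Set ℕ)

theorem step_eq {l : Lab c} {v : Option Γ'} {S : K' ⊕ Bool → List Γ'}
    {s : TM2.Stmt (fun _ : K' ⊕ Bool => Γ') (Lab c) (Option Γ')}
    {d : TM2.Cfg (fun _ : K' ⊕ Bool => Γ') (Lab c) (Option Γ')}
    (h : prog c l = .inl s) (hd : TM2.stepAux s v S = d) :
    (machine c).step X ⟨some l, v, S⟩ = d := by
  subst hd
  simp only [OracleTM.step]
  have h' : (machine c).prog l = .inl s := h
  rw [h']
  rfl

theorem initCfg_eq (x : List Bool) :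
    (machine c).initCfg x = conf c (.inr .init) none [] (x.map bitSymbol) [] := by
  have h : Function.update (fun _ => []) (.inr false) (x.map bitSymbol) =
      stackFn [] (x.map bitSymbol) [] := by
    rw [← update_stackFn_input [] []]
    congr 1
    funext k
    rcases k with k | b
    · cases k <;> rfl
    · cases b <;> rfl
  exact congrArg (TM2.Cfg.mk _ _) h

theorem reaches_read (v : Option Γ') (m i : List Γ') :
    (machine c).Reaches X (conf c (.inr .read) v m i [])
      (conf c (startLab c) none (i.reverse ++ m) [] []) := by
  induction i generalizing v m with
  | nil => exact .single (step_eq X rfl (by simp [TM2.stepAux, conf]))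
  | cons g i ih =>
    refine .head (c' := conf c (.inr .read) (some g) (g :: m) i []) ?_ ?_
    · exact step_eq X rfl (by simp [TM2.stepAux, conf])
    · simpa using ih (some g) (g :: m)

theorem reaches_start (x : List Bool) :
    (machine c).Reaches X ((machine c).initCfg x)
      (conf c (startLab c) none (trList [strNum x + 1, 0]) [] []) := by
  rw [initCfg_eq]
  -- Below the bits of the input lie the leading `1`, the separator that ends this number, and the
  -- separator that ends the number `0`, whose expansion is empty.
  refine .head (c' := conf c (.inr .read) none [.bit1, .cons, .cons] (x.map bitSymbol) []) ?_ ?_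
  · exact step_eq X rfl (by simp [TM2.stepAux, conf])
  · simpa [trNat_strNum_succ] using reaches_read X none [.bit1, .cons, .cons] (x.map bitSymbol)

/-- The leading `1` of the number is also moved to the query stack; it is popped again once the
separator shows that it was not part of the string. -/
theorem reaches_query (v : Option Γ') (y : List Bool) (m q : List Γ') :
    (machine c).Reaches X (conf c (.inr .query) v (y.map bitSymbol ++ .bit1 :: .cons :: m) [] q)
      (conf c (.inr .ask) (some .bit1) m [] ((y.map bitSymbol).reverse ++ q)) := by
  induction y generalizing v q with
  | nil =>
    refine .head (c' := conf c (.inr .query) (some .bit1) (.cons :: m) [] (.bit1 :: q)) ?_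
      (.single ?_)
    · exact step_eq X rfl (by simp [TM2.stepAux, conf])
    · exact step_eq X rfl (by simp [TM2.stepAux, conf])
  | cons b y ih =>
    refine .head (c' := conf c (.inr .query) (some (bitSymbol b))
      (y.map bitSymbol ++ .bit1 :: .cons :: m) [] (bitSymbol b :: q)) ?_ ?_
    · cases b <;> exact step_eq X rfl (by simp [TM2.stepAux, conf, bitSymbol])
    · simpa using ih (some (bitSymbol b)) (bitSymbol b :: q)

theorem reaches_clear (b : Bool) (v : Option Γ') (m q : List Γ') :
    (machine c).Reaches X (conf c (.inr (.clear b)) v m [] q)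
      (conf c (startLab c) none (trNat b.toNat ++ .cons :: m) [] []) := by
  induction q generalizing v with
  | nil =>
    refine .single ?_
    cases b
    · exact step_eq X rfl (by simp [TM2.stepAux, conf])
    · exact step_eq X rfl (by simp [TM2.stepAux, conf, trNat_one])
  | cons g q ih =>
    refine .head (c' := conf c (.inr (.clear b)) (some g) m [] q) ?_ (ih (some g))
    exact step_eq X rfl (by simp [TM2.stepAux, conf])

/-- The embedding of the configurations of the machine for `c`. -/
noncomputable def embed (d : TM2.Cfg (fun _ : K' => Γ') Λ' (Option Γ')) : (machine c).Cfg :=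
  ⟨some (d.l.elim (.inr .post) (lab c)), d.var, Sum.elim d.stk fun _ => []⟩

/-- The type `Λ'` of all labels is infinite, but a run started inside `codeSupp` stays inside it.
The default value of `lab` is therefore never met along the run, and halting of the inner machine
becomes a jump to `post`. -/
theorem reaches_embed {d d' : TM2.Cfg (fun _ : K' => Γ') Λ' (Option Γ')}
    (h : StateTransition.Reaches (TM2.step tr) d d')
    (hd : d.l ∈ Finset.insertNone (codeSupp c Cont'.halt)) :
    (machine c).Reaches X (embed d) (embed d') := by
  let _ : Inhabited Λ' := ⟨trNormal c Cont'.halt⟩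
  suffices H : (machine c).Reaches X (embed d) (embed d') ∧
      d'.l ∈ Finset.insertNone (codeSupp c Cont'.halt) from H.1
  induction h with
  | refl => exact ⟨.refl _, hd⟩
  | @tail e e' _ h ih =>
    obtain ⟨ih, he⟩ := ih
    refine ⟨ih.trans (.single ?_), TM2.step_supports tr (tr_supports c Cont'.halt) h he⟩
    obtain ⟨l, v, S⟩ := e
    cases l with
    | none => exact absurd h (by simp [TM2.step])
    | some l =>
      have hl : l ∈ codeSupp c Cont'.halt := Finset.some_mem_insertNone.1 he
      have hlab : lab c l = .inl ⟨l, hl⟩ := dif_pos hl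
      obtain rfl := Option.some.inj h
      have hprog : prog c (lab c l) =
          .inl (mapStmt Sum.inl (lab c) (some (.inr .post)) (tr l)) := by
        rw [hlab]
        rfl
      refine step_eq X hprog ((stepAux_mapStmt _ _ _ _ _ _).trans ?_)
      simp only [embed]
      cases (TM2.stepAux (tr l) v S).l <;> rfl

theorem reaches_post {l l' : List ℕ} (h : c.eval l = pure l') :
    (machine c).Reaches X (conf c (startLab c) none (trList l) [] [])
      (conf c (.inr .post) none (trList l') [] []) := by
  have hstk : ∀ m, stackFn m [] [] = Sum.elim (K'.elim m [] [] []) fun _ => [] := by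
    intro m
    funext k
    rcases k with k | b
    · rfl
    · cases b <;> rfl
  have hmem : halt l' ∈ StateTransition.eval (TM2.step tr) (PartrecToTM2.init c l) := by
    rw [tr_eval, h]
    exact (Part.mem_map_iff _).2 ⟨l', Part.mem_some _, rfl⟩
  have := reaches_embed (c := c) X (StateTransition.mem_eval.1 hmem).1
    (Finset.some_mem_insertNone.2 (codeSupp_self c _ (trStmts₁_self _)))
  unfold conf
  rw [hstk, hstk]
  exact this

variable {flag nx : ℕ → ℕ → ℕ} {qry : ℕ → ℕ → List Bool}

-- The program outputs the number of the reversed query string, because the least significant bit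
-- lies on top of the stack; moving the bits over then pushes the query in its proper order.
open Classical in
theorem reaches_round
    (hc : ∀ a s, c.eval [a, s] = pure [flag a s, strNum (qry a s).reverse + 1, nx a s])
    {a s : ℕ} (h : flag a s = 0) :
    (machine c).Reaches X (conf c (startLab c) none (trList [a, s]) [] [])
      (conf c (startLab c) none
        (trList [(decide (strNum (qry a s) ∈ X)).toNat, nx a s]) [] []) := by
  refine (reaches_post X (hc a s)).trans ?_
  refine .head (c' := conf c (.inr .query) (some .cons)
    ((qry a s).map bitSymbol ++ .bit1 :: .cons :: trList [nx a s]) [] []) ?_ ?_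
  · rw [h]
    exact step_eq X rfl (by simp [TM2.stepAux, conf, trNat_strNum_succ])
  refine (reaches_query X _ _ _ _).trans (.head ?_ (reaches_clear X _ (some .bit1) _
    ((qry a s).map bitSymbol).reverse))
  rw [List.append_nil]
  have := (machine c).answer_map_reverse X (qry a s)
  rw [← this]
  rfl

/-- The first symbol of the output tells the three cases apart: flag `0` has an empty expansion and
shows a separator (a query), flag `1` shows `bit1` (reject), flag `2` shows `bit0` (accept). -/
theorem halts_of_flag
    (hc : ∀ a s, c.eval [a, s] = pure [flag a s, strNum (qry a s).reverse + 1, nx a s])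
    {a s : ℕ} {b : Bool} (h : flag a s = 1 + b.toNat) :
    ∃ d : (machine c).Cfg,
      (machine c).Reaches X (conf c (startLab c) none (trList [a, s]) [] []) d ∧
        d.l = none ∧ (machine c).out d.var = b := by
  have hf : trNat (1 + b.toNat) = bitSymbol (!b) :: (if b then [Γ'.bit1] else []) := by
    cases b <;> rfl
  refine ⟨⟨none, some (bitSymbol (!b)), stackFn ((if b then [Γ'.bit1] else []) ++
      Γ'.cons :: trList [strNum (qry a s).reverse + 1, nx a s]) [] []⟩,
    (reaches_post X (hc a s)).trans (.single ?_), rfl, ?_⟩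
  · rw [trList, h, hf]
    exact step_eq X rfl (by cases b <;> simp [TM2.stepAux, bitSymbol] <;> rfl)
  · cases b <;> simp [machine, bitSymbol]

end Driver

/-- A search through the initial segments of an oracle can be carried out by an oracle machine. -/
theorem exists_machine_of_search {ρ : List Bool → List Bool → Option Bool} (hρ : Computable₂ ρ) :
    ∃ M : OracleTM, ∀ (X : Set ℕ) (x : List Bool), (∃ b, ρ (initSeg X b) x ≠ none) →
      ∃ t b, (M.run X x t).l = none ∧
        ρ (initSeg X b) x = some (M.out (M.run X x t).var) := by
  classical
  -- the input and the answers so far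
  let dec : ℕ → ℕ → List Bool × List Bool := fun a s =>
    Nat.casesOn s (numStr (a - 1), []) fun s =>
      (((decode (α := List Bool × List Bool) s).getD ([], [])).1,
        ((decode (α := List Bool × List Bool) s).getD ([], [])).2 ++ [decide (a = 1)])
  have hdec : Computable₂ dec := by
    refine Computable.nat_casesOn Computable.snd ?_ ?_
    · exact (computable_numStr.comp (Computable.pred.comp Computable.fst)).pair
        (Computable.const [])
    · have hd : Computable fun p : (ℕ × ℕ) × ℕ =>
          (decode (α := List Bool × List Bool) p.2).getD ([], []) :=
        Computable.option_getD (Computable.decode.comp Computable.snd) (Computable.const _)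
      exact (Computable.fst.comp hd).pair (Computable.list_concat.comp (Computable.snd.comp hd)
        ((Primrec.eq.decide.comp (Primrec.fst.comp Primrec.fst) (Primrec.const 1)).to_comp))
  -- Flag `0` asks for another oracle bit, and the bit requested is the one whose number equals the
  -- count of answers so far. State `0` is reserved for the first round, in which `a` is the input
  -- number plus one; later states are shifted by one and `a` is the latest answer.
  let flag : ℕ → ℕ → ℕ := fun a s =>
    ((ρ (dec a s).2 (dec a s).1).map fun b => 1 + b.toNat).getD 0
  let qry : ℕ → ℕ → List Bool := fun a s => numStr (dec a s).2.length
  let nx : ℕ → ℕ → ℕ := fun a s => encode (dec a s) + 1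
  have hflag : Computable₂ flag := by
    refine Computable.option_getD (Computable.option_map (hρ.comp (Computable.snd.comp hdec)
      (Computable.fst.comp hdec)) ?_) (Computable.const 0)
    exact ((Primrec.dom_bool fun b => 1 + b.toNat).comp Primrec.snd).to_comp
  have hqry : Computable₂ fun a s => strNum (qry a s).reverse + 1 :=
    Computable.succ.comp (primrec_strNum.to_comp.comp (Computable.list_reverse.comp
      (computable_numStr.comp (Computable.list_length.comp (Computable.snd.comp hdec)))))
  have hnx : Computable₂ nx := Computable.succ.comp (Computable.encode.comp hdec)
  have code : ∀ {f : ℕ → ℕ → ℕ}, Computable₂ f →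
      ∃ c : Turing.ToPartrec.Code, ∀ a s, c.eval [a, s] = pure [f a s] := by
    intro f hf
    have h : Computable fun v : List.Vector ℕ 2 => f v.head v.tail.head :=
      hf.comp Computable.vector_head (Computable.vector_head.comp Computable.vector_tail)
    obtain ⟨c, hc⟩ := Turing.ToPartrec.Code.exists_code (Nat.Partrec'.of_part h.partrec)
    refine ⟨c, fun a s => ?_⟩
    exact hc ⟨[a, s], rfl⟩
  obtain ⟨c₁, h₁⟩ := code hflag
  obtain ⟨c₂, h₂⟩ := code hqry
  obtain ⟨c₃, h₃⟩ := code hnx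
  have hc : ∀ a s, (Turing.ToPartrec.Code.cons c₁ (.cons c₂ c₃)).eval [a, s] =
      pure [flag a s, strNum (qry a s).reverse + 1, nx a s] := by
    intro a s
    simp [h₁, h₂, h₃]
  refine ⟨Driver.machine (.cons c₁ (.cons c₂ c₃)), fun X x hx => ?_⟩
  have hmin : ∀ j < Nat.find hx, ρ (initSeg X j) x = none := fun j hj => by
    simpa using Nat.find_min hx hj
  -- As long as the search fails, each round lengthens the known segment by one bit, so the first
  -- successful segment is reached.
  have reach : ∀ j ≤ Nat.find hx, ∃ a s, dec a s = (x, initSeg X j) ∧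
      (Driver.machine (.cons c₁ (.cons c₂ c₃))).Reaches X
        ((Driver.machine (.cons c₁ (.cons c₂ c₃))).initCfg x)
        (Driver.conf _ (Driver.startLab _) none (Turing.PartrecToTM2.trList [a, s]) [] []) := by
    intro j
    induction j with
    | zero =>
      intro _
      exact ⟨strNum x + 1, 0, by simp [dec, initSeg], Driver.reaches_start X x⟩
    | succ j ih =>
      intro hj
      obtain ⟨a, s, hd, hr⟩ := ih (by omega)
      have hf : flag a s = 0 := by simp [flag, hd, hmin j hj]
      refine ⟨_, _, ?_, hr.trans (Driver.reaches_round X hc hf)⟩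
      simp only [nx, qry, dec] at hd ⊢
      simp only [hd, encodek, Option.getD_some, length_initSeg, strNum_numStr, initSeg_succ]
      by_cases hjX : j ∈ X <;> simp [hjX]
  obtain ⟨a, s, hd, t₁, ht₁⟩ := reach _ le_rfl
  obtain ⟨v, hv⟩ := Option.ne_none_iff_exists'.1 (Nat.find_spec hx)
  have hf : flag a s = 1 + v.toNat := by simp [flag, hd, hv]
  obtain ⟨d, ⟨t₂, ht₂⟩, hl, hout⟩ := Driver.halts_of_flag X hc hf
  have hrun : (Driver.machine (.cons c₁ (.cons c₂ c₃))).run X x (t₂ + t₁) = d := by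
    rw [OracleTM.run, Function.iterate_add_apply, ht₁, ht₂]
  exact ⟨t₂ + t₁, Nat.find hx, by rw [hrun]; exact hl, by rw [hrun, hout]; exact hv⟩

/-! ### Prefixing the input -/

namespace OracleTM

variable (M : OracleTM)

/-- Push a list of symbols onto a stack. -/
def pushAll {K Γ Λ σ : Type} (k : K) :
    List Γ → Turing.TM2.Stmt (fun _ : K => Γ) Λ σ → Turing.TM2.Stmt (fun _ : K => Γ) Λ σ
  | [], q => q
  | g :: L, q => .push k (fun _ => g) (pushAll k L q)

theorem stepAux_pushAll {K Γ Λ σ : Type} [DecidableEq K] (k : K) (L : List Γ)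
    (q : Turing.TM2.Stmt (fun _ : K => Γ) Λ σ) (v : σ) (S : K → List Γ) :
    Turing.TM2.stepAux (pushAll k L q) v S =
      Turing.TM2.stepAux q v (Function.update S k (L.reverse ++ S k)) := by
  induction L generalizing S with
  | nil => simp [pushAll]
  | cons g L ih => simp [pushAll, ih]

/-- The machine that puts the string `w` in front of its input and then runs `M`. -/
def prepend (w : List Bool) : OracleTM where
  K := M.K
  Γ := M.Γ
  Λ := M.Λ ⊕ Unit
  σ := M.σ
  inputTape := M.inputTape
  queryTape := M.queryTape
  input_ne_query := M.input_ne_query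
  bit := M.bit
  start := .inr ()
  init := M.init
  prog
    | .inl l => (M.prog l).map (mapStmt id Sum.inl none) fun next b => .inl (next b)
    | .inr () => .inl (pushAll M.inputTape (w.map M.bit).reverse (.goto fun _ => .inl M.start))
  out := M.out

/-- The embedding of the configurations of `M`. -/
def prependCfg (w : List Bool) (c : M.Cfg) : (M.prepend w).Cfg :=
  ⟨c.l.map Sum.inl, c.var, c.stk⟩

theorem step_prependCfg (w : List Bool) (X : Set ℕ) (c : M.Cfg) :
    (M.prepend w).step X (M.prependCfg w c) = M.prependCfg w (M.step X c) := by
  obtain ⟨l, v, S⟩ := c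
  cases l with
  | none => rfl
  | some l =>
    simp only [prependCfg, step, Option.map_some, prepend]
    cases h : M.prog l with
    | inl q => exact stepAux_mapStmt_id _ q v S
    | inr next => rfl

/-- Pushing the fixed string `w` is a single statement and costs exactly one step. -/
theorem run_prepend (w : List Bool) (X : Set ℕ) (x : List Bool) (t : ℕ) :
    (M.prepend w).run X x (t + 1) = M.prependCfg w (M.run X (w ++ x) t) := by
  induction t with
  | zero =>
    have h : (M.prepend w).step X ((M.prepend w).initCfg x) =
        M.prependCfg w (M.initCfg (w ++ x)) := by
      refine (stepAux_pushAll M.inputTape (w.map M.bit).reverse _ M.init _).trans ?_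
      have h : ∀ {K Γ : Type} [DecidableEq K] (k : K) (u v : List Γ),
          Function.update (Function.update (fun _ => []) k u) k
            (v ++ Function.update (fun _ => []) k u k) =
          Function.update (fun _ => []) k (v ++ u) := by
        simp
      simp only [Turing.TM2.stepAux, prependCfg, initCfg, prepend, List.reverse_reverse,
        List.map_append]
      exact congrArg (Turing.TM2.Cfg.mk _ _) (h _ _ _)
    exact h
  | succ t ih => rw [run_succ, ih, step_prependCfg, ← run_succ]

theorem run_prepend_l_eq_none (w : List Bool) (X : Set ℕ) (x : List Bool) (t : ℕ) :
    ((M.prepend w).run X x (t + 1)).l = none ↔ (M.run X (w ++ x) t).l = none := by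
  rw [run_prepend]
  exact Option.map_eq_none_iff

theorem out_run_prepend (w : List Bool) (X : Set ℕ) (x : List Bool) (t : ℕ) :
    (M.prepend w).out ((M.prepend w).run X x (t + 1)).var =
      M.out (M.run X (w ++ x) t).var := by
  rw [run_prepend]
  rfl

end OracleTM

/-! ### Projections of decidable predicates are computably enumerable. -/

open Nat.Partrec (Code)

theorem rePred_exists {α : Type*} [Primcodable α] {r : α → ℕ → Bool} (hr : Computable₂ r) :
    REPred fun a => ∃ n, r a n = true := by
  have h : Partrec fun a => Nat.rfind fun n => (Part.some (r a n) : Part Bool) :=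
    Partrec.rfind (p := fun a n => (Part.some (r a n) : Part Bool)) hr
  refine h.dom_re.of_eq fun a => ?_
  refine Nat.rfind_dom.trans ?_
  refine exists_congr fun n => ⟨fun hn => (Part.mem_some_iff.1 hn.1).symm, fun hn => ?_⟩
  exact ⟨Part.mem_some_iff.2 hn.symm, fun _ => trivial⟩

theorem rePred_exists_of_primrecPred {α : Type*} [Primcodable α] {R : α → ℕ → Prop}
    (hR : PrimrecPred fun p : α × ℕ => R p.1 p.2) : REPred fun a => ∃ n, R a n := by
  obtain ⟨_, hR⟩ := hR
  exact (rePred_exists (r := fun a n => decide (R (a, n).1 (a, n).2)) hR.to_comp).of_eq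
    fun a => by simp only [decide_eq_true_eq]

/-! ### Degrees -/

theorem recursiveIn_of_deg_eq {A B : Set ℕ} (h : deg A = deg B) :
    Nat.RecursiveIn {(charFun B : ℕ →. ℕ)} (charFun A : ℕ →. ℕ) :=
  RecursiveIn.iff_nat.1 (Quotient.exact h).1

theorem computable_charFun {A : Set ℕ} (h : ComputablePred fun n => n ∈ A) :
    Computable (charFun A) := by
  obtain ⟨_, h⟩ := h
  refine (Computable.cond h (Computable.const 1) (Computable.const 0)).of_eq fun n => ?_
  by_cases hn : n ∈ A <;> simp [charFun, hn]

theorem deg_eq_of_computable {A B : Set ℕ} (hA : ComputablePred fun n => n ∈ A)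
    (hB : ComputablePred fun n => n ∈ B) : deg A = deg B :=
  Quotient.sound ⟨(computable_charFun hA).partrec.turingReducible,
    (computable_charFun hB).partrec.turingReducible⟩

/-! ### The languages -/

/-- The computation of `c` on input `n` halts by stage `s`. -/
def HaltsBy (c : Code) (n s : ℕ) : Prop :=
  (c.evaln s n).isSome = true

theorem HaltsBy.mono {c : Code} {n s t : ℕ} (h : HaltsBy c n s) (hst : s ≤ t) : HaltsBy c n t := by
  obtain ⟨v, hv⟩ := Option.isSome_iff_exists.1 h
  exact Option.isSome_iff_exists.2 ⟨v, Code.evaln_mono hst hv⟩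

theorem exists_haltsBy {c : Code} {n : ℕ} : (∃ s, HaltsBy c n s) ↔ (c.eval n).Dom := by
  refine ⟨fun ⟨s, h⟩ => ?_, fun h => ?_⟩
  · obtain ⟨v, hv⟩ := Option.isSome_iff_exists.1 h
    exact Part.dom_iff_mem.2 ⟨v, Code.evaln_sound hv⟩
  · obtain ⟨v, hv⟩ := Part.dom_iff_mem.1 h
    obtain ⟨s, hs⟩ := Code.evaln_complete.1 hv
    exact ⟨s, Option.isSome_iff_exists.2 ⟨v, hs⟩⟩

theorem primrecPred_haltsBy {α : Type*} [Primcodable α] {c : α → Code} {n s : α → ℕ}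
    (hc : Primrec c) (hn : Primrec n) (hs : Primrec s) :
    PrimrecPred fun a => HaltsBy (c a) (n a) (s a) :=
  Primrec.eq.comp (Primrec.option_isSome.comp
    (Code.primrec_evaln.comp ((hs.pair hc).pair hn))) (Primrec.const true)

/-- The computations of the `k`-th code that are relevant for `IsTotalOn k` have converged up to
`m` by stage `s`. -/
def TotalUpTo (k m s : ℕ) : Prop :=
  ∀ v < m + 1, HaltsBy (Denumerable.ofNat Code k) (Nat.pair k v) s

theorem TotalUpTo.mono {k m s t : ℕ} (h : TotalUpTo k m s) (hst : s ≤ t) : TotalUpTo k m t :=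
  fun v hv => (h v hv).mono hst

theorem exists_totalUpTo {k : ℕ} (hk : IsTotalOn k) (m : ℕ) : ∃ s, TotalUpTo k m s := by
  choose s hs using fun v => exists_haltsBy.2 (hk v)
  exact ⟨(Finset.range (m + 1)).sup s, fun v hv =>
    (hs v).mono (Finset.le_sup (Finset.mem_range.2 hv))⟩

theorem primrecPred_totalUpTo {α : Type*} [Primcodable α] {k m s : α → ℕ}
    (hk : Primrec k) (hm : Primrec m) (hs : Primrec s) :
    PrimrecPred fun a => TotalUpTo (k a) (m a) (s a) := by
  have h : PrimrecRel fun (v : ℕ) (p : ℕ × ℕ) =>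
      HaltsBy (Denumerable.ofNat Code p.1) (Nat.pair p.1 v) p.2 :=
    primrecPred_haltsBy ((Primrec.ofNat Code).comp (Primrec.fst.comp Primrec.snd))
      (Primrec₂.natPair.comp (Primrec.fst.comp Primrec.snd) Primrec.fst)
      (Primrec.snd.comp Primrec.snd)
  have h' : PrimrecRel fun (b : ℕ) (p : ℕ × ℕ) =>
      ∀ v < b, HaltsBy (Denumerable.ofNat Code p.1) (Nat.pair p.1 v) p.2 :=
    (h.forall_mem_list.comp (Primrec.list_range.comp Primrec.fst) Primrec.snd).of_eq
      fun p => by simp only [List.mem_range]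
  exact h'.comp (Primrec.succ.comp hm) (hk.pair hs)

/-- `n` is enumerated by `c` at a stage after `m`, but before `IsTotalOn k` is confirmed up
to `m`; the pair of `n` and `m` is coded by `y`. -/
def LatePair (c : Code) (k y : ℕ) : Prop :=
  ∃ s, HaltsBy c y.unpair.1 s ∧ ¬ HaltsBy c y.unpair.1 y.unpair.2 ∧ ¬ TotalUpTo k y.unpair.2 s

/-- Only stages before the first confirmation stage `r` can make a pair late, and by monotonicity it
suffices to look at `r - 1`. Both `LatePair` and its negation thereby become existential. -/
theorem not_latePair_iff {c : Code} {k : ℕ} (hk : IsTotalOn k) (y : ℕ) :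
    ¬ LatePair c k y ↔ ∃ r, TotalUpTo k y.unpair.2 r ∧
      (HaltsBy c y.unpair.1 y.unpair.2 ∨ ¬ HaltsBy c y.unpair.1 (r - 1)) := by
  classical
  constructor
  · intro h
    have hex := exists_totalUpTo hk y.unpair.2
    refine ⟨Nat.find hex, Nat.find_spec hex, ?_⟩
    by_contra! hcon
    refine h ⟨_, hcon.2, hcon.1, fun hT => ?_⟩
    -- For `r = 0` the truncated subtraction gives stage `0`, by which nothing has halted.
    rcases Nat.eq_zero_or_pos (Nat.find hex) with h0 | h0
    · rw [h0] at hcon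
      simp [HaltsBy, Code.evaln] at hcon
    · exact Nat.find_min hex (Nat.pred_lt h0.ne') hT
  · rintro ⟨r, hT, h⟩ ⟨s, hs, hm, hsT⟩
    have hsr : s ≤ r - 1 := by
      by_contra hcon
      exact hsT (hT.mono (by omega))
    exact h.elim hm fun h => h (hs.mono hsr)

theorem computablePred_latePair (c : Code) {k : ℕ} (hk : IsTotalOn k) :
    ComputablePred fun y => LatePair c k y := by
  have hy : Primrec fun p : ℕ × ℕ => p.1.unpair := Primrec.unpair.comp Primrec.fst
  have hn := Primrec.fst.comp hy
  have hm := Primrec.snd.comp hy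
  refine ComputablePred.computable_iff_re_compl_re'.2 ⟨?_, ?_⟩
  · exact rePred_exists_of_primrecPred
      ((primrecPred_haltsBy (Primrec.const c) hn Primrec.snd).and
        ((primrecPred_haltsBy (Primrec.const c) hn hm).not.and
          (primrecPred_totalUpTo (Primrec.const k) hm Primrec.snd).not))
  · refine (rePred_exists_of_primrecPred
      ((primrecPred_totalUpTo (Primrec.const k) hm Primrec.snd).and
        ((primrecPred_haltsBy (Primrec.const c) hn hm).or
          (primrecPred_haltsBy (Primrec.const c) hn
            (Primrec.pred.comp Primrec.snd)).not))).of_eq fun y => (not_latePair_iff hk y).symm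

theorem computablePred_dom_of_latePair {c : Code} {k : ℕ} (hk : ¬ IsTotalOn k)
    (h : ComputablePred fun y => LatePair c k y) : ComputablePred fun n => (c.eval n).Dom := by
  obtain ⟨m, hm⟩ := not_forall.1 hk
  -- At a failure `m` of totality, confirmation never comes, so `(n, m)` is late exactly when `n` is
  -- enumerated after stage `m`.
  have hT : ∀ s, ¬ TotalUpTo k m s := fun s hs =>
    hm (exists_haltsBy.1 ⟨s, hs m (Nat.lt_succ_self m)⟩)
  have hm' : ComputablePred fun n => HaltsBy c n m :=
    (primrecPred_haltsBy (Primrec.const c) Primrec.id (Primrec.const m)).computablePred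
  have hl : ComputablePred fun n => LatePair c k (Nat.pair n m) := by
    obtain ⟨_, h⟩ := h
    exact ⟨_, h.comp (Primrec₂.natPair.comp Primrec.id (Primrec.const m)).to_comp⟩
  have hor : ComputablePred fun n => HaltsBy c n m ∨ LatePair c k (Nat.pair n m) := by
    classical
    exact ((Primrec.or.to_comp.comp hm'.decide hl.decide).of_eq fun n =>
      (Bool.decide_or _ _).symm).computablePred
  refine hor.of_eq fun n => ?_
  rw [← exists_haltsBy]
  simp only [LatePair, Nat.unpair_pair]
  constructor
  · rintro (h | ⟨s, h, _⟩)
    · exact ⟨m, h⟩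
    · exact ⟨s, h⟩
  · rintro ⟨s, h⟩
    by_cases hnm : HaltsBy c n m
    · exact .inl hnm
    · exact .inr ⟨s, h, hnm, hT s⟩

open Classical in
/-- An oracle for the domain of `c` decides `LatePair c` uniformly. -/
theorem recursiveIn_latePair {c : Code} {O : Set (ℕ →. ℕ)} {W : Set ℕ}
    (hc : ∀ n, n ∈ W ↔ (c.eval n).Dom) (hW : Nat.RecursiveIn O (charFun W : ℕ →. ℕ)) :
    Nat.RecursiveIn O (charFun {y | LatePair c y.unpair.1 y.unpair.2} : ℕ →. ℕ) := by
  have hq : Primrec fun p : ℕ × ℕ => p.1.unpair := Primrec.unpair.comp Primrec.fst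
  have hy : Primrec fun p : ℕ × ℕ => p.1.unpair.1.unpair :=
    Primrec.unpair.comp (Primrec.fst.comp hq)
  have hz : Primrec fun p : ℕ × ℕ => p.1.unpair.1.unpair.2.unpair :=
    Primrec.unpair.comp (Primrec.snd.comp hy)
  have h0 : PrimrecPred fun p : ℕ × ℕ => p.1.unpair.2 = 0 :=
    Primrec.eq.comp (Primrec.snd.comp hq) (Primrec.const 0)
  have hHs : PrimrecPred fun p : ℕ × ℕ => HaltsBy c p.1.unpair.1.unpair.2.unpair.1 p.2 :=
    primrecPred_haltsBy (Primrec.const c) (Primrec.fst.comp hz) Primrec.snd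
  have hHm : PrimrecPred fun p : ℕ × ℕ =>
      HaltsBy c p.1.unpair.1.unpair.2.unpair.1 p.1.unpair.1.unpair.2.unpair.2 :=
    primrecPred_haltsBy (Primrec.const c) (Primrec.fst.comp hz) (Primrec.snd.comp hz)
  have hT : PrimrecPred fun p : ℕ × ℕ =>
      TotalUpTo p.1.unpair.1.unpair.1 p.1.unpair.1.unpair.2.unpair.2 p.2 :=
    primrecPred_totalUpTo (Primrec.fst.comp hy) (Primrec.snd.comp hz) Primrec.snd
  -- The input is paired with the oracle bit for `n ∈ W`. With bit `0` the search stops at once and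
  -- the answer is no. Otherwise it waits for the first stage at which `n` appears; as confirmations
  -- persist, this stage is the only one to test.
  let F : ℕ → Part ℕ := fun q => (Nat.rfind fun s => (Part.some (decide (q.unpair.2 = 0 ∨
      HaltsBy c q.unpair.1.unpair.2.unpair.1 s)) : Part Bool)).map fun s =>
    if q.unpair.2 = 0 ∨ HaltsBy c q.unpair.1.unpair.2.unpair.1 q.unpair.1.unpair.2.unpair.2 ∨
      TotalUpTo q.unpair.1.unpair.1 q.unpair.1.unpair.2.unpair.2 s then 0 else 1
  have hF : Nat.Partrec F := by
    refine Partrec.nat_iff.1 (Partrec.map (Partrec.rfind ?_) ?_)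
    · exact (h0.or hHs).decide.to_comp
    · exact (Primrec.ite (h0.or (hHm.or hT)) (Primrec.const 0) (Primrec.const 1)).to_comp
  have hn : Nat.RecursiveIn O ((fun y => Nat.pair y (charFun W y.unpair.2.unpair.1) : ℕ → ℕ) :
      ℕ →. ℕ) :=
    recursiveIn_pair (recursiveIn_of_computable Computable.id) (recursiveIn_comp hW
      (recursiveIn_of_computable (Primrec.fst.comp (Primrec.unpair.comp
        (Primrec.snd.comp Primrec.unpair))).to_comp))
  refine ((Nat.Partrec.recursiveIn hF).comp hn).of_eq_tot fun y => ?_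
  refine Part.mem_bind_iff.2 ⟨_, Part.mem_some _, ?_⟩
  by_cases hy : y.unpair.2.unpair.1 ∈ W
  · have hex := exists_haltsBy.2 ((hc _).1 hy)
    refine (Part.mem_map_iff _).2 ⟨Nat.find hex, ?_, ?_⟩
    · refine Nat.mem_rfind.2 ⟨?_, fun hs => ?_⟩
      · simpa using .inr (Nat.find_spec hex)
      · simpa [charFun, hy] using Nat.find_min hex hs
    · simp only [Nat.unpair_pair, charFun, hy, if_true, one_ne_zero, false_or, Set.mem_ofPred_eq]
      have hiff : LatePair c y.unpair.1 y.unpair.2 ↔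
          ¬ (HaltsBy c y.unpair.2.unpair.1 y.unpair.2.unpair.2 ∨
            TotalUpTo y.unpair.1 y.unpair.2.unpair.2 (Nat.find hex)) := by
        constructor
        · rintro ⟨s, hs, hm, hsT⟩ (h | h)
          · exact hm h
          · exact hsT (h.mono (Nat.find_min' hex hs))
        · intro h
          rw [not_or] at h
          exact ⟨_, Nat.find_spec hex, h⟩
      simp only [hiff]
      split_ifs <;> rfl
  · refine (Part.mem_map_iff _).2 ⟨0, ?_, ?_⟩
    · refine Nat.mem_rfind.2 ⟨?_, fun hs => absurd hs (Nat.not_lt_zero _)⟩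
      simp [charFun, hy]
    · have hnot : ¬ LatePair c y.unpair.1 y.unpair.2 := fun ⟨s, hs, _⟩ =>
        hy ((hc _).2 (exists_haltsBy.1 ⟨s, hs⟩))
      simp [charFun, hy, hnot]

/-! ### Deciding all the languages with one machine -/

/-- The prefix of the inputs that concern the `k`-th language. -/
def unaryPrefix (k : ℕ) : List Bool :=
  (List.range k).map (fun _ => true) ++ [false]

theorem primrec_unaryPrefix : Primrec unaryPrefix :=
  Primrec.list_append.comp (Primrec.list_map Primrec.list_range (Primrec.const true).to₂)
    (Primrec.const [false])

theorem findIdx_unaryPrefix (k : ℕ) (x : List Bool) :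
    (unaryPrefix k ++ x).findIdx (fun b => !b) = k := by
  have h : (List.replicate k true ++ [false] ++ x).findIdx (fun b => !b) = k := by
    induction k with
    | zero => rfl
    | succ k ih => simpa [List.replicate_succ, List.findIdx_cons] using ih
  simpa [unaryPrefix] using h

theorem drop_unaryPrefix (k : ℕ) (x : List Bool) : (unaryPrefix k ++ x).drop (k + 1) = x :=
  List.drop_left' (by simp [unaryPrefix])

/-- One machine serves all `k`, so that quantifying over `k` later changes only the prefix of the
input. -/
theorem exists_machine_of_recursiveIn {X L : Set ℕ}
    (hL : Nat.RecursiveIn {(charFun X : ℕ →. ℕ)} (charFun L : ℕ →. ℕ)) :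
    ∃ M : OracleTM, ∀ k x, ∃ t, (M.run X (unaryPrefix k ++ x) t).l = none ∧
      (M.out (M.run X (unaryPrefix k ++ x) t).var = true ↔ Nat.pair k (strNum x) ∈ L) := by
  obtain ⟨ρ, hρ, h⟩ := exists_primrec_search hL
  let i : List Bool → ℕ := fun z => z.findIdx fun b => !b
  have hi : Primrec i := Primrec.list_findIdx Primrec.id (Primrec.not.comp Primrec.snd)
  let y : List Bool → ℕ := fun z => Nat.pair (i z) (strNum (z.drop (i z + 1)))
  have hy : Primrec y := Primrec₂.natPair.comp hi
    (primrec_strNum.comp (Primrec.list_drop.comp (Primrec.succ.comp hi) Primrec.id))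
  have hyz : ∀ k x, y (unaryPrefix k ++ x) = Nat.pair k (strNum x) := fun k x => by
    simp only [y, i, findIdx_unaryPrefix, drop_unaryPrefix]
  obtain ⟨M, hM⟩ := exists_machine_of_search
    (ρ := fun τ z => (ρ τ (y z)).map fun v => decide (v = 1))
    (Primrec.option_map (hρ.comp Primrec.fst (hy.comp Primrec.snd))
      (Primrec.eq.decide.comp Primrec.snd (Primrec.const 1)).to₂).to_comp
  refine ⟨M, fun k x => ?_⟩
  have hsome : ∃ b, ρ (initSeg X b) (Nat.pair k (strNum x)) =
    some (charFun L (Nat.pair k (strNum x))) := (h _ _).1 (Part.mem_some _)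
  obtain ⟨t, b, ht, hb⟩ := hM X (unaryPrefix k ++ x) (by
    obtain ⟨b, hb⟩ := hsome
    exact ⟨b, by simp [hyz, hb]⟩)
  refine ⟨t, ht, ?_⟩
  rw [hyz, Option.map_eq_some_iff] at hb
  obtain ⟨v, hv, hvM⟩ := hb
  obtain rfl := Part.mem_some_iff.1 ((h _ _).2 ⟨b, hv⟩)
  rw [← hvM, decide_eq_true_eq]
  by_cases hmem : Nat.pair k (strNum x) ∈ L <;> simp [charFun, hmem]

/-! ### Polynomial time bounds -/

theorem monotone_polynomial_eval (p : Polynomial ℕ) : Monotone fun n => p.eval n := by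
  intro a b hab
  simp only [Polynomial.eval_eq_sum, Polynomial.sum]
  exact Finset.sum_le_sum fun i _ => Nat.mul_le_mul_left _ (Nat.pow_le_pow_left hab i)

theorem primrec_polynomial_eval (p : Polynomial ℕ) : Primrec fun n => p.eval n := by
  induction p using Polynomial.induction_on' with
  | add p q hp hq => exact (Primrec.nat_add.comp hp hq).of_eq fun n => Polynomial.eval_add.symm
  | monomial k a =>
    have hpow : Primrec fun n : ℕ => n ^ k := by
      induction k with
      | zero => exact (Primrec.const 1).of_eq fun n => (pow_zero n).symm
      | succ k ih => exact (Primrec.nat_mul.comp ih Primrec.id).of_eq fun n => (pow_succ n k).symm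
    exact (Primrec.nat_mul.comp (Primrec.const a) hpow).of_eq fun n =>
      Polynomial.eval_monomial.symm

/-- The index `c` gives, as a function of the input and a time bound, the answers of a machine
without oracle that is polynomially slower than `M` on the inputs that start with `w`; the value
`0` stands for no answer and `1 + b` for the answer `b`. -/
def Simulates (M : OracleTM) (X : Set ℕ) (w : List Bool) (c : ℕ) : Prop :=
  ∀ x t T, (M.run X (w ++ x) t).l = none →
    OracleCode.primrecUniv c (Nat.pair (encode x) (t + 1)) =
        1 + (M.out (M.run X (w ++ x) t).var).toNat ∧
      (OracleCode.primrecUniv c (Nat.pair (encode x) T) = 0 ∨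
        OracleCode.primrecUniv c (Nat.pair (encode x) T) =
          1 + (M.out (M.run X (w ++ x) t).var).toNat)

/-- Lowness for speed is applied to `M.prepend w` with its exact running time as `f`. Stopping the
resulting machine after `p.eval T` steps gives a primitive recursive function of the input and `T`,
which has an index. -/
theorem exists_simulates {M : OracleTM} {X : Set ℕ} (hX : LowForSpeed X) {w : List Bool}
    {L : Set (List Bool)} (hL : ComputablePred fun x => x ∈ L)
    (hM : ∀ x, ∃ t, (M.run X (w ++ x) t).l = none ∧
      (M.out (M.run X (w ++ x) t).var = true ↔ x ∈ L)) : ∃ c, Simulates M X w c := by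
  classical
  have hM' : ∀ x t, (M.run X (w ++ x) t).l = none →
      (M.out (M.run X (w ++ x) t).var = true ↔ x ∈ L) := by
    intro x t ht
    obtain ⟨s, hs, h⟩ := hM x
    rcases le_total s t with hst | hst
    · rwa [M.run_of_halted hst hs]
    · rwa [← M.run_of_halted hst ht]
  have hex : ∀ x, ∃ t, (M.run X (w ++ x) t).l = none := fun x =>
    (hM x).imp fun _ h => h.1
  -- The bound is the least halting time of `M`, plus one for the step that pushes the prefix; this
  -- is the `t + 1` in `Simulates`.
  obtain ⟨N, p, hN, hNp⟩ := hX L (fun x => Nat.find (hex x) + 1) hL ⟨M.prepend w, fun x =>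
    ⟨(M.run_prepend_l_eq_none w X x _).2 (Nat.find_spec (hex x)), by
      rw [M.out_run_prepend]
      exact hM' x _ (Nat.find_spec (hex x))⟩⟩
  obtain ⟨c, hc⟩ := OracleCode.exists_primrecUniv_eq (f := fun q =>
    ((N.segOut [] ((decode (α := List Bool) q.unpair.1).getD []) (p.eval q.unpair.2)).map
      fun b => 1 + b.toNat).getD 0) (by
    refine Primrec.nat_iff.1 (Primrec.option_getD.comp (Primrec.option_map (N.primrec_segOut.comp
      ((Primrec.const []).pair ((Primrec.option_getD.comp (Primrec.decode.comp
        (Primrec.fst.comp Primrec.unpair)) (Primrec.const [])).pair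
        ((primrec_polynomial_eval p).comp (Primrec.snd.comp Primrec.unpair))))) ?_)
      (Primrec.const 0))
    exact (Primrec.dom_bool fun b => 1 + b.toNat).comp Primrec.snd)
  refine ⟨c, fun x t T ht => ?_⟩
  -- A halted configuration no longer changes, so an answer given under any budget is the correct
  -- one.
  have hval : ∀ T b, N.segOut [] x (p.eval T) = some b →
      b = M.out (M.run X (w ++ x) t).var := by
    intro T b hb
    obtain ⟨h1, h2⟩ := N.segOut_sound (X := ∅) (b := 0) hb
    have hx : b = true ↔ x ∈ L := by
      rw [← h2, ← (hNp x).2]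
      rcases le_total (p.eval T) (p.eval (Nat.find (hex x) + 1)) with h | h
      · rw [N.run_of_halted h h1]
      · rw [N.run_of_halted h (hNp x).1]
    exact Bool.eq_iff_iff.2 (hx.trans (hM' x t ht).symm)
  have hc' : ∀ T, OracleCode.primrecUniv c (Nat.pair (encode x) T) =
      ((N.segOut [] x (p.eval T)).map fun b => 1 + b.toNat).getD 0 := fun T => by
    rw [hc]
    simp
  constructor
  · have hle : p.eval (Nat.find (hex x) + 1) ≤ p.eval (t + 1) :=
      monotone_polynomial_eval p (Nat.succ_le_succ (Nat.find_min' (hex x) ht))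
    have hhalt : (N.run ∅ x (p.eval (t + 1))).l = none := by
      rw [N.run_of_halted hle (hNp x).1]
      exact (hNp x).1
    have := N.segOut_of_oracleFree hN (τ := []) hhalt
    rw [hc', this, ← hval _ _ this]
    rfl
  · rw [hc']
    cases h : N.segOut [] x (p.eval T) with
    | none => exact .inl rfl
    | some b => exact .inr (by rw [hval _ _ h]; rfl)

/-- The running time of `M` need not be known: increasing budgets are tried until a nonzero value
appears. One clause of `Simulates` guarantees that this happens, the other that the value is right.
The values `2` and `1` enumerate the language and its complement. -/
theorem Simulates.computablePred {M : OracleTM} {X : Set ℕ} {w : List Bool} {c : ℕ}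
    (h : Simulates M X w c) {L : Set (List Bool)}
    (hM : ∀ x, ∃ t, (M.run X (w ++ x) t).l = none ∧
      (M.out (M.run X (w ++ x) t).var = true ↔ x ∈ L)) : ComputablePred fun x => x ∈ L := by
  have hval : ∀ v : ℕ, Computable₂ fun (x : List Bool) (T : ℕ) =>
      decide (OracleCode.primrecUniv c (Nat.pair (encode x) T) = v) := fun v =>
    Primrec.eq.decide.to_comp.comp (OracleCode.computable_primrecUniv.comp (Computable.const c)
      (Primrec₂.natPair.to_comp.comp (Computable.encode.comp Computable.fst) Computable.snd))
      (Computable.const v)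
  have hiff : ∀ x, ∃ b : Bool, (b = true ↔ x ∈ L) ∧
      ∀ v, 0 < v → ((∃ T, decide (OracleCode.primrecUniv c (Nat.pair (encode x) T) = v) = true) ↔
        v = 1 + b.toNat) := by
    intro x
    obtain ⟨t, ht, hb⟩ := hM x
    refine ⟨_, hb, fun v hv => ⟨?_, ?_⟩⟩
    · rintro ⟨T, hT⟩
      rw [decide_eq_true_eq] at hT
      rcases (h x t T ht).2 with h0 | h0
      · omega
      · rw [← hT, h0]
    · rintro rfl
      exact ⟨t + 1, decide_eq_true (h x t 0 ht).1⟩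
  refine ComputablePred.computable_iff_re_compl_re'.2
    ⟨(rePred_exists (hval 2)).of_eq fun x => ?_, (rePred_exists (hval 1)).of_eq fun x => ?_⟩
  · obtain ⟨b, hb, h⟩ := hiff x
    rw [h 2 (by omega), ← hb]
    cases b <;> simp
  · obtain ⟨b, hb, h⟩ := hiff x
    rw [h 1 (by omega), ← hb]
    cases b <;> simp

/-- A failure of `Simulates` consists of `x`, `t`, `T` and a segment of `X` on which `M` halts
within `t` steps. As `primrecUniv` is total, `B` can test such a failure computably, so `Simulates`
is universal relative to `X`. -/
theorem isSigmaTwo_exists_simulates {A X : Set ℕ}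
    (hX : Nat.RecursiveIn {(charFun A : ℕ →. ℕ)} (charFun X : ℕ →. ℕ))
    (hA : Nat.RecursiveIn {(charFun (jump ∅) : ℕ →. ℕ)} (charFun (jump A) : ℕ →. ℕ))
    (M : OracleTM) {w : ℕ → List Bool} (hw : Primrec w) :
    IsSigmaTwo fun k => ∃ c, Simulates M X (w k) c := by
  let U : ℕ → List Bool → ℕ → ℕ := fun c x T => OracleCode.primrecUniv c (Nat.pair (encode x) T)
  let B : ℕ × ℕ × ℕ → List Bool → Bool := fun q τ =>
    ((decode (α := List Bool × ℕ × ℕ) q.2.2).bind fun r =>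
      (M.segOut τ (w q.1 ++ r.1) r.2.1).map fun a =>
        !(decide (U q.2.1 r.1 (r.2.1 + 1) = 1 + a.toNat) &&
          (decide (U q.2.1 r.1 r.2.2 = 0) || decide (U q.2.1 r.1 r.2.2 = 1 + a.toNat)))).getD false
  have hB : Computable₂ B := by
    have hO : Computable fun p : ((ℕ × ℕ × ℕ) × List Bool) × List Bool × ℕ × ℕ =>
        M.segOut p.1.2 (w p.1.1.1 ++ p.2.1) p.2.2.1 := by
      have h : Primrec fun p : ((ℕ × ℕ × ℕ) × List Bool) × List Bool × ℕ × ℕ =>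
          (p.1.2, w p.1.1.1 ++ p.2.1, p.2.2.1) :=
        (Primrec.snd.comp Primrec.fst).pair ((Primrec.list_append.comp
          (hw.comp (Primrec.fst.comp (Primrec.fst.comp Primrec.fst)))
          (Primrec.fst.comp Primrec.snd)).pair (Primrec.fst.comp (Primrec.snd.comp Primrec.snd)))
      exact (M.primrec_segOut.comp h).to_comp
    have hC : Computable fun p : (((ℕ × ℕ × ℕ) × List Bool) × List Bool × ℕ × ℕ) × Bool =>
        !(decide (U p.1.1.1.2.1 p.1.2.1 (p.1.2.2.1 + 1) = 1 + p.2.toNat) &&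
          (decide (U p.1.1.1.2.1 p.1.2.1 p.1.2.2.2 = 0) ||
            decide (U p.1.1.1.2.1 p.1.2.1 p.1.2.2.2 = 1 + p.2.toNat))) := by
      have hU : ∀ {T : (((ℕ × ℕ × ℕ) × List Bool) × List Bool × ℕ × ℕ) × Bool → ℕ}, Primrec T →
          Computable fun p => U p.1.1.1.2.1 p.1.2.1 (T p) := fun hT =>
        OracleCode.computable_primrecUniv.comp (Primrec.fst.comp (Primrec.snd.comp
          (Primrec.fst.comp (Primrec.fst.comp Primrec.fst)))).to_comp
          (Primrec₂.natPair.comp (Primrec.encode.comp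
            (Primrec.fst.comp (Primrec.snd.comp Primrec.fst))) hT).to_comp
      have ht : Primrec fun p : (((ℕ × ℕ × ℕ) × List Bool) × List Bool × ℕ × ℕ) × Bool =>
          p.1.2.2 := Primrec.snd.comp (Primrec.snd.comp Primrec.fst)
      have ha : Computable fun p : (((ℕ × ℕ × ℕ) × List Bool) × List Bool × ℕ × ℕ) × Bool =>
          1 + p.2.toNat := ((Primrec.dom_bool fun b => 1 + b.toNat).comp Primrec.snd).to_comp
      have heq : Computable₂ fun a b : ℕ => decide (a = b) := Primrec.eq.decide.to_comp
      have h1 := heq.comp (hU (Primrec.succ.comp (Primrec.fst.comp ht))) ha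
      have h2 := heq.comp (hU (Primrec.snd.comp ht)) (Computable.const 0)
      have h3 := heq.comp (hU (Primrec.snd.comp ht)) ha
      have h4 := Primrec.not.to_comp.comp
        (Primrec.and.to_comp.comp h1 (Primrec.or.to_comp.comp h2 h3))
      exact h4
    have hD : Computable fun p : (ℕ × ℕ × ℕ) × List Bool =>
        decode (α := List Bool × ℕ × ℕ) p.1.2.2 :=
      Computable.decode.comp (Computable.snd.comp (Computable.snd.comp Computable.fst))
    exact Computable.option_getD (Computable.option_bind hD (Computable.option_map hO hC.to₂).to₂)
      (Computable.const false)
  refine (isSigmaTwo_of_low hX hA hB).of_eq fun k => exists_congr fun c =>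
    ⟨fun h => ?_, fun h => ?_⟩
  · intro x t T ht
    obtain ⟨b, hb⟩ := M.segOut_complete ht
    have := h (encode (x, t, T)) b
    simpa [B, hb, U, or_iff_not_imp_left] using this
  · intro m b
    simp only [B]
    cases hm : decode (α := List Bool × ℕ × ℕ) m with
    | none => rfl
    | some r =>
      cases hs : M.segOut (initSeg X b) (w k ++ r.1) r.2.1 with
      | none => simp [hs]
      | some a =>
        obtain ⟨h1, rfl⟩ := M.segOut_sound hs
        simpa [hs, U, or_iff_not_imp_left] using h r.1 r.2.1 r.2.2 h1

/-- The core of the argument, for sets instead of degrees. -/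
theorem computablePred_of_lowForSpeed {A X W : Set ℕ} (hW : REPred fun n => n ∈ W)
    (hWX : Nat.RecursiveIn {(charFun X : ℕ →. ℕ)} (charFun W : ℕ →. ℕ))
    (hXA : Nat.RecursiveIn {(charFun A : ℕ →. ℕ)} (charFun X : ℕ →. ℕ))
    (hA : Nat.RecursiveIn {(charFun (jump ∅) : ℕ →. ℕ)} (charFun (jump A) : ℕ →. ℕ))
    (hX : LowForSpeed X) : ComputablePred fun n => n ∈ W := by
  obtain ⟨c, hc⟩ : ∃ c : Code, ∀ n, n ∈ W ↔ (c.eval n).Dom := by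
    obtain ⟨c, hc⟩ := Code.exists_code.1 (Partrec.nat_iff.1
      (hW.map (Computable.const 0).to₂))
    refine ⟨c, fun n => ?_⟩
    rw [hc]
    simp [Part.assert]
  by_contra hcon
  obtain ⟨M, hM⟩ := exists_machine_of_recursiveIn (recursiveIn_latePair hc hWX)
  let L : ℕ → Set (List Bool) := fun k => {x | LatePair c k (strNum x)}
  have hML : ∀ k x, ∃ t, (M.run X (unaryPrefix k ++ x) t).l = none ∧
      (M.out (M.run X (unaryPrefix k ++ x) t).var = true ↔ x ∈ L k) := by
    intro k x
    simpa [L] using hM k x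
  -- It remains to see that `k` is total exactly when a simulating index exists. For the direction
  -- from an index to totality, a failure of totality would make `W` computable.
  refine not_isSigmaTwo_isTotalOn ((isSigmaTwo_exists_simulates hXA hA M
    primrec_unaryPrefix).of_eq fun k => ⟨fun ⟨d, hd⟩ => ?_, fun hk => ?_⟩)
  · by_contra hk
    obtain ⟨_, hL⟩ := hd.computablePred (hML k)
    have hL' : ComputablePred fun y => LatePair c k y :=
      ComputablePred.of_eq ⟨fun y => inferInstance, hL.comp computable_numStr⟩
        fun y => by simp [L]
    exact hcon ((computablePred_dom_of_latePair hk hL').of_eq fun n => (hc n).symm)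
  · obtain ⟨_, h⟩ := computablePred_latePair c hk
    have hL : ComputablePred fun x => LatePair c k (strNum x) :=
      ⟨fun _ => inferInstance, h.comp primrec_strNum.to_comp⟩
    exact exists_simulates hX (L := L k) (hL.of_eq fun _ => Iff.rfl) (hML k)

end LowSpeed

theorem mainTheorem4 (a : TuringDegree) (hce : LowSpeed.IsCEDegree a)
    (hlow : LowSpeed.IsLowDegree a) (hpos : LowSpeed.deg ∅ < a) :
    a ∉ LowSpeed.LFSDegrees := by
  rintro ⟨X, rfl, hX⟩
  obtain ⟨W, hW, hWX⟩ := hce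
  obtain ⟨A, hAX, hA⟩ := hlow
  have hWc := LowSpeed.computablePred_of_lowForSpeed hW (LowSpeed.recursiveIn_of_deg_eq hWX)
    (LowSpeed.recursiveIn_of_deg_eq hAX.symm) (LowSpeed.recursiveIn_of_deg_eq hA) hX
  refine hpos.ne ((LowSpeed.deg_eq_of_computable ?_ hWc).trans hWX)
  exact ⟨fun _ => isFalse id, Computable.const false⟩
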